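/- Let $\mathcal A$ be a finite alphabet and let $X\subset\mathcal A^{\mathbb Z}$ be a subshift, i.e. a closed subset invariant under the shift $\sigma$, $(\sigma x)_n=x_{n+1}$, and its inverse. Assume that $X$ is aperiodic, i.e. that $X$ contains no $\sigma$-periodic point. Let $p_X(n)$ be the number of words of length $n$ that occur in points of $X$, that is, $p_X(n)=\#\{x_mx_{m+1}\cdots x_{m+n-1} : x\in X,\ m\in\mathbb Z\}$, and let $k\in\mathbb N$ be such that $$\liminf_{n\to\infty}\frac{p_X(n)}{n}\le k .$$ For an invertible bounded linear operator $U$ of a real normed space $E$, let $\mathrm{Mult}(U)\in\mathbb N\cup\{\infty\}$ be the smallest cardinality of a set $F\subset E$ such that the linear span of $\{U^j x : j\in\mathbb Z,\ x\in F\}$ is dense in $E$ (so $\mathrm{Mult}(U)=0$ if $E=\{0\}$). For an ergodic $\sigma$-invariant Borel probability measure $\mu$ on $X$, let $\mathrm{Mult}(\mu)$ be the multiplicity of the operator $\phi\mapsto\phi\circ\sigma$ on the real Hilbert space $L^2_0(\mu)=\{\phi\in L^2(\mu) : \int\phi\,d\mu=0\}$. Then $$\sum_{\mu\in\mathcal M_e(X,\sigma)}\mathrm{Mult}(\mu)\le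 2k ,$$ where $\mathcal M_e(X,\sigma)$ is the set of all ergodic $\sigma$-invariant Borel probability measures on $X$. -/

import Mathlib

open MeasureTheory Filter Topology
open scoped ENNReal

namespace SubshiftMult

/-! ### Multiplicity of an invertible bounded operator -/

section Multiplicity

/-- `F` is a generating family of `U`: the linear span of the vectors `U ^ k x`, with `k ∈ ℤ` and
`x ∈ F`, is dense. -/
def IsGenerating {E : Type*} [NormedAddCommGroup E] [NormedSpace ℝ E] (U : E ≃L[ℝ] E)
    (F : Set E) : Prop :=
  Dense (Submodule.span ℝ {y : E | ∃ k : ℤ, ∃ x ∈ F, y = (U ^ k) x} : Set E)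

/-- The smallest cardinality of a generating family of `U`, in `ℕ ∪ {∞}` (it is `0` for the
zero space, where the empty family is generating). -/
noncomputable def Mult {E : Type*} [NormedAddCommGroup E] [NormedSpace ℝ E] (U : E ≃L[ℝ] E) : ℕ∞ :=
  ⨅ (F : Set E) (_ : IsGenerating U F), F.encard

end Multiplicity

/-! ### The Koopman operator on mean-zero square-integrable functions -/

section Koopman

variable {α : Type*} [MeasurableSpace α]

/-- The operator `φ ↦ φ ∘ T` on the real Hilbert space `L²(μ)`, for an invertible
measure-preserving map `T`. -/
noncomputable def koopman (T : α ≃ᵐ α) (μ : Measure α) (hT : MeasurePreserving T μ μ) :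
    Lp ℝ 2 μ ≃L[ℝ] Lp ℝ 2 μ where
  toLinearMap := Lp.compMeasurePreservingₗ ℝ T hT
  invFun := Lp.compMeasurePreserving T.symm (hT.symm T)
  left_inv f := by
    have h : (T : α → α) ∘ T.symm = id := T.self_comp_symm
    change Lp.compMeasurePreserving T.symm (hT.symm T) (Lp.compMeasurePreserving T hT f) = f
    rw [← Lp.compMeasurePreserving_comp_apply]
    simp only [h, Lp.compMeasurePreserving_id_apply]
  right_inv f := by
    have h : (T.symm : α → α) ∘ T = id := T.symm_comp_self
    change Lp.compMeasurePreserving T hT (Lp.compMeasurePreserving T.symm (hT.symm T) f) = f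
    rw [← Lp.compMeasurePreserving_comp_apply]
    simp only [h, Lp.compMeasurePreserving_id_apply]
  continuous_toFun := (Lp.isometry_compMeasurePreserving hT).continuous
  continuous_invFun := (Lp.isometry_compMeasurePreserving (hT.symm T)).continuous

/-- The space `L²₀(μ)` of the `f ∈ L²(μ)` with `∫ f dμ = 0`. -/
def L20 (μ : Measure α) [IsFiniteMeasure μ] : Submodule ℝ (Lp ℝ 2 μ) where
  carrier := {f | ∫ x, f x ∂μ = 0}
  zero_mem' := by
    change ∫ x, (0 : Lp ℝ 2 μ) x ∂μ = 0
    rw [integral_congr_ae (Lp.coeFn_zero ℝ 2 μ)]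
    simp
  add_mem' {f g} hf hg := by
    have hf' : Integrable f μ := (Lp.memLp f).integrable (by norm_num)
    have hg' : Integrable g μ := (Lp.memLp g).integrable (by norm_num)
    simp only [Set.mem_ofPred_eq] at hf hg ⊢
    rw [integral_congr_ae (Lp.coeFn_add f g)]
    simp only [Pi.add_apply]
    rw [integral_add hf' hg', hf, hg, add_zero]
  smul_mem' c f hf := by
    simp only [Set.mem_ofPred_eq] at hf ⊢
    rw [integral_congr_ae (Lp.coeFn_smul c f)]
    simp only [Pi.smul_apply]
    rw [integral_smul, hf, smul_zero]

theorem integral_koopman (T : α ≃ᵐ α) (μ : Measure α) (hT : MeasurePreserving T μ μ)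
    (f : Lp ℝ 2 μ) : ∫ x, koopman T μ hT f x ∂μ = ∫ x, f x ∂μ := by
  have h : (koopman T μ hT f : α → ℝ) =ᵐ[μ] f ∘ T := Lp.coeFn_compMeasurePreserving f hT
  rw [integral_congr_ae h]
  exact hT.integral_comp T.measurableEmbedding f

theorem map_koopman_L20 (T : α ≃ᵐ α) (μ : Measure α) [IsFiniteMeasure μ]
    (hT : MeasurePreserving T μ μ) :
    (L20 μ).map (koopman T μ hT : Lp ℝ 2 μ →ₗ[ℝ] Lp ℝ 2 μ) = L20 μ := by
  ext f
  constructor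
  · rintro ⟨g, hg, rfl⟩
    exact (integral_koopman T μ hT g).trans hg
  · intro hf
    refine ⟨(koopman T μ hT).symm f, ?_, (koopman T μ hT).apply_symm_apply f⟩
    have h := integral_koopman T μ hT ((koopman T μ hT).symm f)
    rw [(koopman T μ hT).apply_symm_apply f] at h
    exact h.symm.trans hf

/-- The restriction of the operator `φ ↦ φ ∘ T` to `L²₀(μ)`. -/
noncomputable def koopman0 (T : α ≃ᵐ α) (μ : Measure α) [IsFiniteMeasure μ]
    (hT : MeasurePreserving T μ μ) : L20 μ ≃L[ℝ] L20 μ :=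
  (koopman T μ hT).ofSubmodules (L20 μ) (L20 μ) (map_koopman_L20 T μ hT)

/-- The ergodic multiplicity of `μ`: the multiplicity of `φ ↦ φ ∘ T` on `L²₀(μ)`. -/
noncomputable def ergodicMult (T : α ≃ᵐ α) (μ : Measure α) [IsProbabilityMeasure μ]
    (hT : Ergodic T μ) : ℕ∞ :=
  Mult (koopman0 T μ hT.toMeasurePreserving)

end Koopman

/-! ### Subshifts over `ℤ` -/

section Subshift

open SymbolicDynamics.FullShift

variable {A : Type*} [TopologicalSpace A]

/-- The set `𝓛ₙ(X)` of words `x_m x_{m+1} ⋯ x_{m+n-1}` with `x ∈ X` and `m ∈ ℤ`. -/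
def words (X : Subshift A ℤ) (n : ℕ) : Set (Fin n → A) :=
  {w | ∃ x ∈ X.carrier, ∃ m : ℤ, ∀ i : Fin n, w i = x (m + (i : ℕ))}

/-- The word complexity `p_X(n)`, the number of words of length `n` of `X`. -/
noncomputable def complexity (X : Subshift A ℤ) (n : ℕ) : ℕ :=
  (words X n).ncard

/-- `X` contains no periodic point of the shift. -/
def IsAperiodic (X : Subshift A ℤ) : Prop :=
  ∀ x ∈ X.carrier, ∀ n : ℕ, 0 < n → shift (n : ℤ) x ≠ x

/-- The shift `(σ x)_n = x_{n+1}`, as a homeomorphism of `X`. -/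
def sigma (X : Subshift A ℤ) : X.carrier ≃ₜ X.carrier where
  toFun x := ⟨shift (1 : ℤ) x.1, X.mapsTo 1 x.2⟩
  invFun x := ⟨shift (-1 : ℤ) x.1, X.mapsTo (-1) x.2⟩
  left_inv x := by
    ext n
    simp
  right_inv x := by
    ext n
    simp
  continuous_toFun := by fun_prop
  continuous_invFun := by fun_prop

/-- The ergodic measures of `(X, σ)`: the `σ`-invariant ergodic Borel probability measures. -/
def ErgodicMeasure [MeasurableSpace A] (X : Subshift A ℤ) : Type _ :=
  {μ : ProbabilityMeasure X.carrier // Ergodic (sigma X) (μ : Measure X.carrier)}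

/-- The ergodic multiplicity `Mult(μ)` of an ergodic measure `μ` of `(X, σ)`. -/
noncomputable def ErgodicMeasure.mult [Finite A] [DiscreteTopology A] [MeasurableSpace A]
    [BorelSpace A] {X : Subshift A ℤ} (μ : ErgodicMeasure X) : ℕ∞ :=
  ergodicMult (sigma X).toMeasurableEquiv (μ.1 : Measure X.carrier) μ.2

end Subshift

end SubshiftMult

/-! Since the liminf is at most `k`, there are arbitrarily large `n` with `p(n+1) - p(n) ≤ k`
(`frequently_complexity_succ_le`). A right special word with `d` extensions contributes `d ≤ 2(d-1)`
words, so at most `2k` words of length `n+1` extend right special words (`ncard_specialWords`).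
Between visits to right special words every new letter is forced, so first returns cut `X` into at
most `2k` towers, and a given cylinder function is constant on every level once `n` is large
(`exists_towers`, `exists_level_const`).

Fix an ultrafilter finer than `atTop` and attach to each ergodic `μ` the set of towers whose
`μ`-mass stays bounded below along it (`towerIndices`). The other towers are negligible in `L²`, so
the indicators of the remaining bases approximately generate `L²(μ)` (`approx_towers`). A Baire
argument turns approximate generation by a fixed number of vectors into genuine generation
(`mult_le_of_approx`), so `Mult(μ)` is at most the size of this set (`ergodicMult_le`).

For distinct measures the sets are disjoint (`disjoint_towerIndices`): along one tower the average
of a cylinder function is the same for all invariant measures, whereas mutual singularity provides a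
function close to 1 for `μ` and close to 0 for `ν`. Disjoint subsets of a set of `2k` indices have
total size at most `2k`. -/

namespace SubshiftMult

section Abstract

open Polynomial

/-! ### Spans of orbits and polynomials in an invertible operator -/

section Span

variable {E : Type*} [NormedAddCommGroup E] [NormedSpace ℝ E]

/-- The span of the orbits of the points of `F` under `U`. -/
def orbitSpan (U : E ≃L[ℝ] E) (F : Set E) : Submodule ℝ E :=
  Submodule.span ℝ {y : E | ∃ k : ℤ, ∃ x ∈ F, y = (U ^ k) x}

theorem zpow_apply_zpow (U : E ≃L[ℝ] E) (m n : ℤ) (x : E) :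
    (U ^ m) ((U ^ n) x) = (U ^ (m + n)) x := by
  rw [zpow_add]
  rfl

theorem zpow_mem_orbitSpan (U : E ≃L[ℝ] E) {F : Set E} {x : E} (hx : x ∈ F) (k : ℤ) :
    (U ^ k) x ∈ orbitSpan U F :=
  Submodule.subset_span ⟨k, x, hx, rfl⟩

theorem mem_orbitSpan (U : E ≃L[ℝ] E) {F : Set E} {x : E} (hx : x ∈ F) :
    x ∈ orbitSpan U F := by
  exact zpow_mem_orbitSpan U hx 0

theorem orbitSpan_le (U : E ≃L[ℝ] E) {F : Set E} {K : Submodule ℝ E}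
    (hK : ∀ x ∈ F, ∀ k : ℤ, (U ^ k) x ∈ K) : orbitSpan U F ≤ K :=
  Submodule.span_le.2 (by rintro _ ⟨k, x, hx, rfl⟩; exact hK x hx k)

theorem map_zpow_orbitSpan (U : E ≃L[ℝ] E) {F : Set E} (m : ℤ) {y : E}
    (hy : y ∈ orbitSpan U F) : (U ^ m) y ∈ orbitSpan U F := by
  have : orbitSpan U F ≤ (orbitSpan U F).comap ((U ^ m : E ≃L[ℝ] E) : E →ₗ[ℝ] E) := by
    refine orbitSpan_le U fun x hx k => ?_
    have h := zpow_mem_orbitSpan U hx (m + k)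
    rw [zpow_add] at h
    exact h
  exact this hy

theorem map_zpow_closure_orbitSpan (U : E ≃L[ℝ] E) {F : Set E} (m : ℤ) {y : E}
    (hy : y ∈ (orbitSpan U F).topologicalClosure) :
    (U ^ m) y ∈ (orbitSpan U F).topologicalClosure := by
  have hy' : y ∈ closure (orbitSpan U F : Set E) := hy
  exact map_mem_closure (U ^ m : E ≃L[ℝ] E).continuous hy'
    fun z hz => map_zpow_orbitSpan U m hz

theorem isGenerating_iff (U : E ≃L[ℝ] E) (F : Set E) :
    IsGenerating U F ↔ ∀ x, x ∈ (orbitSpan U F).topologicalClosure :=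
  Iff.rfl

/-- Keep the coefficients and exponents of a finite combination and let the family vary. This gives
the openness needed for Baire's theorem. -/
theorem exists_continuous_orbitSpan {ι : Type*} (U : E ≃L[ℝ] E) (f₀ : ι → E) {y : E}
    (hy : y ∈ orbitSpan U (Set.range f₀)) :
    ∃ Y : (ι → E) → E, Continuous Y ∧ Y f₀ = y ∧ ∀ f, Y f ∈ orbitSpan U (Set.range f) := by
  refine Submodule.span_induction ?_ ?_ ?_ ?_ hy
  · rintro _ ⟨k, _, ⟨i, rfl⟩, rfl⟩
    exact ⟨fun f => (U ^ k) (f i), by fun_prop, rfl,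
      fun f => zpow_mem_orbitSpan U (Set.mem_range_self i) k⟩
  · exact ⟨fun _ => 0, continuous_const, rfl, fun f => Submodule.zero_mem _⟩
  · rintro x y - - ⟨X, hX, rfl, hX'⟩ ⟨Y, hY, rfl, hY'⟩
    exact ⟨fun f => X f + Y f, hX.add hY, rfl, fun f => Submodule.add_mem _ (hX' f) (hY' f)⟩
  · rintro a x - ⟨X, hX, rfl, hX'⟩
    exact ⟨fun f => a • X f, hX.const_smul a, rfl, fun f => Submodule.smul_mem _ a (hX' f)⟩

/-- The action of a polynomial in the operator `U`. -/
noncomputable def polyOp (U : E ≃L[ℝ] E) (p : ℝ[X]) : E →L[ℝ] E :=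
  aeval (U : E →L[ℝ] E) p

theorem polyOp_mul (U : E ≃L[ℝ] E) (p q : ℝ[X]) (x : E) :
    polyOp U (p * q) x = polyOp U p (polyOp U q x) := by
  simp [polyOp]

theorem polyOp_add (U : E ≃L[ℝ] E) (p q : ℝ[X]) (x : E) :
    polyOp U (p + q) x = polyOp U p x + polyOp U q x := by
  simp [polyOp]

theorem polyOp_sum (U : E ≃L[ℝ] E) {ι : Type*} (s : Finset ι) (p : ι → ℝ[X]) (x : E) :
    polyOp U (∑ i ∈ s, p i) x = ∑ i ∈ s, polyOp U (p i) x := by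
  simp [polyOp]

@[simp] theorem polyOp_zero (U : E ≃L[ℝ] E) (x : E) : polyOp U 0 x = 0 := by simp [polyOp]

@[simp] theorem polyOp_one (U : E ≃L[ℝ] E) (x : E) : polyOp U 1 x = x := by simp [polyOp]

@[simp] theorem polyOp_C (U : E ≃L[ℝ] E) (c : ℝ) (x : E) : polyOp U (C c) x = c • x := by
  simp [polyOp, Algebra.algebraMap_eq_smul_one]

@[simp] theorem polyOp_X_pow (U : E ≃L[ℝ] E) (n : ℕ) (x : E) :
    polyOp U (X ^ n) x = (U ^ (n : ℤ)) x := by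
  induction n with
  | zero => simp; rfl
  | succ n ih =>
    rw [pow_succ', polyOp_mul, ih, Nat.cast_succ, add_comm, zpow_add, zpow_one]
    simp only [polyOp, aeval_X]
    rfl

theorem polyOp_mem {U : E ≃L[ℝ] E} {K : Submodule ℝ E} (hK : ∀ x ∈ K, U x ∈ K) (p : ℝ[X])
    {x : E} (hx : x ∈ K) : polyOp U p x ∈ K := by
  induction p using Polynomial.induction_on' with
  | add p q hp hq => rw [polyOp_add]; exact K.add_mem hp hq
  | monomial n c =>
    rw [← C_mul_X_pow_eq_monomial, polyOp_mul, polyOp_C]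
    refine K.smul_mem c ?_
    induction n with
    | zero => simpa
    | succ n ih =>
      rw [pow_succ', polyOp_mul]
      simpa [polyOp] using hK _ ih

theorem polyOp_mem_orbitSpan (U : E ≃L[ℝ] E) {F : Set E} (p : ℝ[X]) {x : E}
    (hx : x ∈ orbitSpan U F) : polyOp U p x ∈ orbitSpan U F :=
  polyOp_mem (fun y hy => by simpa using map_zpow_orbitSpan U 1 hy) p hx

/-- Up to a power of `U`, the elements of the span of the orbits are polynomial combinations. -/
theorem exists_polyOp_of_mem_orbitSpan {ι : Type*} [Fintype ι] [DecidableEq ι] (U : E ≃L[ℝ] E)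
    (e : ι → E) {y : E} (hy : y ∈ orbitSpan U (Set.range e)) :
    ∃ N₀ : ℕ, ∀ N : ℕ, N₀ ≤ N →
      ∃ p : ι → ℝ[X], (U ^ (N : ℤ)) y = ∑ i, polyOp U (p i) (e i) := by
  refine Submodule.span_induction ?_ ?_ ?_ ?_ hy
  · rintro _ ⟨k, _, ⟨i, rfl⟩, rfl⟩
    refine ⟨k.natAbs, fun N hN => ⟨Pi.single i (X ^ (N + k).toNat), ?_⟩⟩
    rw [Finset.sum_eq_single i]
    · rw [Pi.single_eq_same, polyOp_X_pow, Int.toNat_of_nonneg (by omega), zpow_add]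
      rfl
    · intro j _ hj
      rw [Pi.single_eq_of_ne hj, polyOp_zero]
    · simp
  · exact ⟨0, fun N _ => ⟨0, by simp⟩⟩
  · rintro x y - - ⟨N₁, h₁⟩ ⟨N₂, h₂⟩
    refine ⟨max N₁ N₂, fun N hN => ?_⟩
    obtain ⟨p, hp⟩ := h₁ N (le_trans (le_max_left _ _) hN)
    obtain ⟨q, hq⟩ := h₂ N (le_trans (le_max_right _ _) hN)
    exact ⟨p + q, by
      simp only [map_add, hp, hq, Pi.add_apply, polyOp_add, Finset.sum_add_distrib]⟩
  · rintro a x - ⟨N₁, h₁⟩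
    refine ⟨N₁, fun N hN => ?_⟩
    obtain ⟨p, hp⟩ := h₁ N hN
    exact ⟨fun i => C a * p i, by
      simp only [map_smul, hp, polyOp_mul, polyOp_C, Finset.smul_sum]⟩

theorem orbitSpan_zpow_le (U : E ≃L[ℝ] E) {ι : Type*} (e : ι → E) (N : ℤ) :
    orbitSpan U (Set.range e) ≤ orbitSpan U (Set.range fun i => (U ^ N) (e i)) := by
  refine orbitSpan_le U ?_
  rintro _ ⟨i, rfl⟩ k
  have := zpow_mem_orbitSpan U (Set.mem_range_self (f := fun i => (U ^ N) (e i)) i) (k - N)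
  rwa [zpow_apply_zpow, sub_add_cancel] at this

/-- Cramer's rule: the adjugate times `M` is the scalar matrix `det M`. -/
theorem polyOp_det_mem {ι : Type*} [Fintype ι] [DecidableEq ι] (U : E ≃L[ℝ] E)
    (M : Matrix ι ι ℝ[X]) (e : ι → E) (j : ι) :
    polyOp U M.det (e j) ∈
      orbitSpan U (Set.range fun i => ∑ l, polyOp U (M i l) (e l)) := by
  have h : polyOp U M.det (e j) =
      ∑ i, polyOp U (M.adjugate j i) (∑ l, polyOp U (M i l) (e l)) := by
    have h1 : ∀ l, ∑ i, M.adjugate j i * M i l = if j = l then M.det else 0 := fun l => by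
      rw [← Matrix.mul_apply, Matrix.adjugate_mul, Matrix.smul_apply, Matrix.one_apply]
      simp
    simp only [map_sum, ← polyOp_mul]
    rw [Finset.sum_comm]
    simp only [← polyOp_sum, h1]
    rw [Finset.sum_eq_single j] <;> simp +contextual [eq_comm]
  rw [h]
  exact Submodule.sum_mem _ fun i _ => polyOp_mem_orbitSpan U _ (mem_orbitSpan U ⟨i, rfl⟩)

end Span

/-! ### Unitary operators: perturbation of families and the Baire argument -/

section Hilbert

variable {H : Type*} [NormedAddCommGroup H] [InnerProductSpace ℝ H]

open scoped InnerProductSpace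

theorem map_orthogonal {U : H ≃L[ℝ] H} (hU : ∀ x y, ⟪U x, U y⟫_ℝ = ⟪x, y⟫_ℝ)
    {K : Submodule ℝ H} (hK' : ∀ x ∈ K, U.symm x ∈ K) : ∀ x ∈ Kᗮ, U x ∈ Kᗮ := by
  intro x hx
  rw [Submodule.mem_orthogonal] at hx ⊢
  intro y hy
  have := hU (U.symm y) x
  rw [U.apply_symm_apply] at this
  rw [this]
  exact hx _ (hK' y hy)

/-- Both `K` and `Kᗮ` are stable under `q(U)`, so `q(U) w` lies in both. -/
theorem polyOp_eq_zero_of_orthogonal {U : H ≃L[ℝ] H} (hU : ∀ x y, ⟪U x, U y⟫_ℝ = ⟪x, y⟫_ℝ)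
    {K : Submodule ℝ H} (hK : ∀ x ∈ K, U x ∈ K) (hK' : ∀ x ∈ K, U.symm x ∈ K) (q : ℝ[X])
    {v w : H} (hv : v ∈ K) (hw : w ∈ Kᗮ) (h : polyOp U q (v + w) ∈ K) : polyOp U q w = 0 := by
  have h1 : polyOp U q v ∈ K := polyOp_mem hK q hv
  have h2 : polyOp U q w ∈ Kᗮ := polyOp_mem (map_orthogonal hU hK') q hw
  rw [map_add] at h
  have h3 : polyOp U q w ∈ K := by
    have := K.sub_mem h h1
    simpa using this
  exact inner_self_eq_zero.1 ((Submodule.mem_orthogonal _ _).1 h2 _ h3)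

/-- Peel off irreducible factors: for `q = i * a`, either `a(U)` already kills `x`, or `a(U) x` is a
nonzero vector killed by `i(U)`. -/
theorem exists_irreducible_ker {U : H ≃L[ℝ] H} {q : ℝ[X]} (hq : q ≠ 0) {x : H} (hx : x ≠ 0)
    (hqx : polyOp U q x = 0) :
    ∃ p : ℝ[X], p ∣ q ∧ p.Monic ∧ Irreducible p ∧ ∃ x, x ≠ 0 ∧ polyOp U p x = 0 := by
  induction q using WfDvdMonoid.induction_on_irreducible generalizing x with
  | zero => exact absurd rfl hq
  | unit u hu =>
    obtain ⟨v, hv⟩ := hu.exists_left_inv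
    have := polyOp_mul U v u x
    rw [hv, hqx, map_zero, polyOp_one] at this
    exact absurd this hx
  | mul a i ha hi ih =>
    rw [polyOp_mul] at hqx
    by_cases h : polyOp U a x = 0
    · obtain ⟨p, hp, h⟩ := ih ha hx h
      exact ⟨p, hp.mul_left i, h⟩
    · refine ⟨i * C i.leadingCoeff⁻¹, ?_, monic_mul_leadingCoeff_inv hi.ne_zero,
        irreducible_mul_leadingCoeff_inv.2 hi, _, h, ?_⟩
      · refine ⟨C i.leadingCoeff * a, ?_⟩
        have : C i.leadingCoeff⁻¹ * C i.leadingCoeff = (1 : ℝ[X]) := by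
          rw [← C_mul, inv_mul_cancel₀ (leadingCoeff_ne_zero.2 hi.ne_zero), C_1]
        linear_combination -(i * a) * this
      · rw [polyOp_mul, polyOp_C, map_smul, hqx, smul_zero]

variable [CompleteSpace H]

theorem exists_add_orthogonal (K : Submodule ℝ H) (hK : IsClosed (K : Set H)) (x : H) :
    ∃ v ∈ K, ∃ w ∈ Kᗮ, x = v + w := by
  have : CompleteSpace K := hK.completeSpace_coe
  obtain ⟨v, hv, w, hw, h⟩ := K.exists_add_mem_mem_orthogonal x
  exact ⟨v, hv, w, hw, h⟩

theorem mem_of_polyOp_mem {U : H ≃L[ℝ] H} (hU : ∀ x y, ⟪U x, U y⟫_ℝ = ⟪x, y⟫_ℝ)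
    {K : Submodule ℝ H} (hKc : IsClosed (K : Set H)) (hK : ∀ x ∈ K, U x ∈ K)
    (hK' : ∀ x ∈ K, U.symm x ∈ K) {q : ℝ[X]}
    (hq : ∀ x, polyOp U q x = 0 → x = 0) {x : H} (hx : polyOp U q x ∈ K) : x ∈ K := by
  obtain ⟨v, hv, w, hw, rfl⟩ := exists_add_orthogonal K hKc x
  have := hq _ (polyOp_eq_zero_of_orthogonal hU hK hK' q hv hw hx)
  rw [this, add_zero]
  exact hv

/-- The component of `y` in the kernel of `p(U)` is killed by both `p(U)` and `q(U)`, hence vanishes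
by Bézout. -/
theorem inner_eq_zero_of_isCoprime {U : H ≃L[ℝ] H} (hU : ∀ x y, ⟪U x, U y⟫_ℝ = ⟪x, y⟫_ℝ)
    {p q : ℝ[X]} (hpq : IsCoprime p q) {x y : H} (hx : polyOp U p x = 0)
    (hy : polyOp U q y = 0) : ⟪x, y⟫_ℝ = 0 := by
  let K : Submodule ℝ H := LinearMap.ker (polyOp U p : H →ₗ[ℝ] H)
  have hmem : ∀ z, z ∈ K ↔ polyOp U p z = 0 := fun z => LinearMap.mem_ker
  have hKc : IsClosed (K : Set H) := by
    have : (K : Set H) = (polyOp U p) ⁻¹' {0} := by ext z; exact hmem z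
    rw [this]
    exact isClosed_singleton.preimage (polyOp U p).continuous
  have hcomm : ∀ z, polyOp U p (U z) = U (polyOp U p z) := fun z => by
    have h1 := polyOp_mul U p X z
    have h2 := polyOp_mul U X p z
    rw [mul_comm] at h2
    simpa [polyOp] using h1.symm.trans h2
  have hK : ∀ z ∈ K, U z ∈ K := fun z hz => by
    rw [hmem] at hz ⊢; rw [hcomm, hz, map_zero]
  have hK' : ∀ z ∈ K, U.symm z ∈ K := fun z hz => by
    rw [hmem] at hz ⊢
    apply U.injective
    rw [← hcomm, U.apply_symm_apply, hz, map_zero]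
  obtain ⟨v, hv, w, hw, rfl⟩ := exists_add_orthogonal K hKc y
  have hw0 : polyOp U q w = 0 :=
    polyOp_eq_zero_of_orthogonal hU hK hK' q hv hw (by rw [hy]; exact K.zero_mem)
  have hv0 : polyOp U q v = 0 := by rw [map_add, hw0, add_zero] at hy; exact hy
  have hv1 : v = 0 := by
    obtain ⟨a, b, hab⟩ := hpq
    have := congrArg (fun r => polyOp U r v) hab
    simp only [polyOp_add, polyOp_mul, (hmem v).1 hv, hv0, map_zero, add_zero, polyOp_one] at this
    exact this.symm
  rw [hv1, zero_add]
  exact (Submodule.mem_orthogonal _ _).1 hw _ ((hmem x).2 hx)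

/-- Only countably many monic irreducible polynomials in a unitary operator of a separable space
have a kernel. -/
theorem countable_irreducible_ker [SecondCountableTopology H] {U : H ≃L[ℝ] H}
    (hU : ∀ x y, ⟪U x, U y⟫_ℝ = ⟪x, y⟫_ℝ) :
    {p : ℝ[X] | p.Monic ∧ Irreducible p ∧ ∃ x, x ≠ 0 ∧ polyOp U p x = 0}.Countable := by
  set S := {p : ℝ[X] | p.Monic ∧ Irreducible p ∧ ∃ x, x ≠ 0 ∧ polyOp U p x = 0}
  have h : ∀ p : S, ∃ x, ‖x‖ = 1 ∧ polyOp U p.1 x = 0 := by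
    rintro ⟨p, -, -, x, hx, hpx⟩
    exact ⟨‖x‖⁻¹ • x, norm_smul_inv_norm hx, by simp [hpx]⟩
  choose x hx hpx using h
  have horth : ∀ p q : S, p ≠ q → ⟪x p, x q⟫_ℝ = 0 := by
    intro p q hpq
    refine inner_eq_zero_of_isCoprime hU ?_ (hpx p) (hpx q)
    refine (p.2.2.1.coprime_iff_not_dvd).2 fun hd => hpq ?_
    exact Subtype.ext (eq_of_monic_of_associated p.2.1 q.2.1
      (p.2.2.1.associated_of_dvd q.2.2.1 hd))
  -- Orthonormal vectors are at distance `√2 > 1`.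
  have hdisj : Pairwise (Function.onFun Disjoint fun p : S => Metric.ball (x p) (1 / 2)) := by
    intro p q hpq
    refine Metric.ball_disjoint_ball ?_
    have h2 : dist (x p) (x q) ^ 2 = 2 := by
      rw [dist_eq_norm, norm_sub_sq_real, hx, hx, horth p q hpq]; norm_num
    nlinarith [dist_nonneg (x := x p) (y := x q)]
  have := Pairwise.countable_of_isOpen_disjoint hdisj (fun _ => Metric.isOpen_ball)
    fun p => ⟨x p, Metric.mem_ball_self (by norm_num)⟩
  exact Set.countable_coe_iff.1 this

/-- If `Q(t) ≠ 0`, a kernel vector yields an irreducible factor `p` of `Q(t)` from a countable set.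
As `Q` is monic, it stays nonzero over the field `ℝ[X]/(p)`, so `p ∣ Q(t)` for only finitely many
`t`; likewise `Q(t) = 0` for only finitely many `t`. -/
theorem countable_eval_ker [SecondCountableTopology H] {U : H ≃L[ℝ] H}
    (hU : ∀ x y, ⟪U x, U y⟫_ℝ = ⟪x, y⟫_ℝ) {Q : ℝ[X][X]} (hQ : Q.Monic) :
    {t : ℝ | ∃ x, x ≠ 0 ∧ polyOp U (Q.eval (C t)) x = 0}.Countable := by
  have h0 : {t : ℝ | Q.eval (C t) = 0}.Countable := by
    refine Set.Finite.countable ?_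
    refine Set.Finite.of_injOn (f := C) (t := Q.rootSet ℝ[X]) ?_ C_injective.injOn
      (Q.rootSet_finite _)
    intro t ht
    rw [mem_rootSet]
    exact ⟨hQ.ne_zero, by simpa [aeval_def] using ht⟩
  have h1 : ∀ p : ℝ[X], Irreducible p → {t : ℝ | p ∣ Q.eval (C t)}.Countable := by
    intro p hp
    have : Fact (Irreducible p) := ⟨hp⟩
    refine Set.Finite.countable ?_
    refine Set.Finite.of_injOn (f := AdjoinRoot.of p)
      (t := (Q.map (AdjoinRoot.mk p)).rootSet (AdjoinRoot p)) ?_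
      (AdjoinRoot.of p).injective.injOn (rootSet_finite _ _)
    intro t ht
    rw [mem_rootSet]
    refine ⟨(hQ.map _).ne_zero, ?_⟩
    have := (AdjoinRoot.mk_eq_zero (f := p)).2 ht
    rw [aeval_def, Algebra.algebraMap_self, eval₂_id, eval_map, ← AdjoinRoot.mk_C, eval₂_at_apply]
    exact this
  refine (h0.union ((countable_irreducible_ker hU).biUnion fun p hp => h1 p hp.2.1)).mono ?_
  rintro t ⟨x, hx, hqx⟩
  by_cases hq : Q.eval (C t) = 0
  · exact Or.inl hq
  · obtain ⟨p, hpd, hp⟩ := exists_irreducible_ker hq hx hqx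
    exact Or.inr (Set.mem_biUnion (x := p) hp hpd)


/-- Write `g = P(U) e'` with a polynomial matrix `P` and put `f = (P + t)(U) e'` for small `t`. For
all but countably many `t`, `det(P + t)(U)` is injective, and then `e'` can be recovered from `f` up
to closure. -/
theorem exists_perturbation [SecondCountableTopology H] {U : H ≃L[ℝ] H}
    (hU : ∀ x y, ⟪U x, U y⟫_ℝ = ⟪x, y⟫_ℝ) {ι : Type*} [Fintype ι] [DecidableEq ι]
    (e g : ι → H) (hg : ∀ i, g i ∈ orbitSpan U (Set.range e)) {δ : ℝ} (hδ : 0 < δ) :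
    ∃ f : ι → H, (∀ i, ‖f i - g i‖ < δ) ∧
      orbitSpan U (Set.range e) ≤ (orbitSpan U (Set.range f)).topologicalClosure := by
  choose N₀ hN₀ using fun i => exists_polyOp_of_mem_orbitSpan U e (hg i)
  set N : ℕ := Finset.univ.sup N₀
  choose P hP using fun i => hN₀ i N (Finset.le_sup (f := N₀) (Finset.mem_univ i))
  set e' : ι → H := fun i => (U ^ (-N : ℤ)) (e i) with he'
  have hcomm : ∀ (n : ℤ) (p : ℝ[X]) x, polyOp U p ((U ^ n) x) = (U ^ n) (polyOp U p x) := by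
    intro n p x
    induction p using Polynomial.induction_on' with
    | add p q hp hq => rw [polyOp_add, polyOp_add, hp, hq, map_add]
    | monomial m c =>
      rw [← C_mul_X_pow_eq_monomial, polyOp_mul, polyOp_mul, polyOp_C, polyOp_C, map_smul,
        polyOp_X_pow, polyOp_X_pow, zpow_apply_zpow, zpow_apply_zpow, add_comm]
  have hgP : ∀ i, g i = ∑ l, polyOp U (P i l) (e' l) := by
    intro i
    have h1 := zpow_apply_zpow U (-N : ℤ) (N : ℤ) (g i)
    rw [neg_add_cancel, hP, map_sum] at h1
    simp only [he', hcomm]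
    exact h1.symm
  obtain ⟨η, hη, hηe⟩ : ∃ η > 0, ∀ i, η * ‖e' i‖ < δ := by
    refine ⟨δ / (1 + ∑ i, ‖e' i‖), by positivity, fun i => ?_⟩
    rw [div_mul_eq_mul_div, div_lt_iff₀ (by positivity)]
    have := Finset.single_le_sum (f := fun i => ‖e' i‖) (fun i _ => norm_nonneg _)
      (Finset.mem_univ i)
    nlinarith
  -- The sign makes `det(P + t)` the characteristic polynomial of `M` at `t`, which is monic.
  let M : Matrix ι ι ℝ[X] := -(Matrix.of P)
  obtain ⟨t, ht, htη⟩ : ∃ t : ℝ, t ∈ Set.Ioo 0 η ∧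
      ¬ ∃ x, x ≠ 0 ∧ polyOp U (M.charpoly.eval (C t)) x = 0 := by
    by_contra! hcon
    have : (Set.Ioo 0 η).Countable :=
      (countable_eval_ker hU (Matrix.charpoly_monic M)).mono fun t ht => hcon t ht
    exact not_le_of_gt hη (Cardinal.Real.Ioo_countable_iff.1 this)
  rw [Matrix.eval_charpoly] at htη
  set M' : Matrix ι ι ℝ[X] := Matrix.scalar ι (C t) - M with hM'
  set f : ι → H := fun i => ∑ l, polyOp U (M' i l) (e' l) with hf
  have hfg : ∀ i, f i = g i + t • e' i := by
    intro i
    rw [hf, hgP]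
    have : ∀ l, polyOp U (M' i l) (e' l) =
        polyOp U (P i l) (e' l) + if i = l then t • e' i else 0 := by
      intro l
      have : M' i l = P i l + if i = l then C t else 0 := by
        simp [hM', M, Matrix.diagonal_apply, add_comm]
      rw [this, polyOp_add]
      split_ifs with h
      · rw [polyOp_C, h]
      · rw [polyOp_zero]
    simp [this, Finset.sum_add_distrib]
  refine ⟨f, fun i => ?_, ?_⟩
  · rw [hfg, add_sub_cancel_left, norm_smul, Real.norm_of_nonneg ht.1.le]
    exact (mul_le_mul_of_nonneg_right ht.2.le (norm_nonneg _)).trans_lt (hηe i)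
  · refine (orbitSpan_zpow_le U e (-N)).trans (orbitSpan_le U ?_)
    rintro _ ⟨j, rfl⟩ k
    refine map_zpow_closure_orbitSpan U k ?_
    -- By Cramer's rule `det(M')(U) e'_j` is in the span; injectivity of `det(M')(U)` lets the
    -- determinant be cancelled in the closed span.
    refine mem_of_polyOp_mem hU (Submodule.isClosed_topologicalClosure _)
      (fun x hx => ?_) (fun x hx => ?_) (q := M'.det) (fun x hx => ?_) ?_
    · simpa using map_zpow_closure_orbitSpan U 1 hx
    · exact map_zpow_closure_orbitSpan U (-1) hx
    · by_contra hx0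
      exact htη ⟨x, hx0, hx⟩
    · exact Submodule.le_topologicalClosure _ (polyOp_det_mem U M' e' j)

/-- A unitary operator of a separable real Hilbert space, whose vectors are approximated by
elements of the spans of the orbits of families indexed by `ι`, has a generating family indexed
by `ι`. -/
theorem mult_le_of_approx [SecondCountableTopology H] {U : H ≃L[ℝ] H}
    (hU : ∀ x y, ⟪U x, U y⟫_ℝ = ⟪x, y⟫_ℝ) {ι : Type*} [Fintype ι]
    {α : Type*} {l : Filter α} [l.NeBot] (e : α → ι → H)
    (he : ∀ h : H, ∀ ε > 0, ∀ᶠ n in l, ∃ y ∈ orbitSpan U (Set.range (e n)), ‖y - h‖ < ε) :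
    Mult U ≤ Fintype.card ι := by
  classical
  have hopen : ∀ (h : H) (ε : ℝ),
      IsOpen {f : ι → H | ∃ y ∈ orbitSpan U (Set.range f), ‖y - h‖ < ε} := by
    intro h ε
    rw [isOpen_iff_mem_nhds]
    rintro f₀ ⟨y, hy, hyε⟩
    obtain ⟨Y, hY, rfl, hYm⟩ := exists_continuous_orbitSpan U f₀ hy
    have : IsOpen {f | ‖Y f - h‖ < ε} :=
      isOpen_lt (hY.sub continuous_const).norm continuous_const
    exact mem_of_superset (this.mem_nhds hyε) fun f hf => ⟨Y f, hYm f, hf⟩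
  have hdense : ∀ (h : H) (ε : ℝ), 0 < ε →
      Dense {f : ι → H | ∃ y ∈ orbitSpan U (Set.range f), ‖y - h‖ < ε} := by
    intro h ε hε
    rw [Metric.dense_iff]
    intro g r hr
    -- One `n` must serve both to approximate the centre `g`, leaving room for the perturbation, and
    -- to approximate `h`.
    have h1 : ∀ᶠ n in l, ∀ i, ∃ y ∈ orbitSpan U (Set.range (e n)), ‖y - g i‖ < r / 2 :=
      eventually_all.2 fun i => he (g i) (r / 2) (half_pos hr)
    obtain ⟨n, hn, y, hy, hyh⟩ := (h1.and (he h ε hε)).exists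
    choose g' hg' hgg' using hn
    obtain ⟨f, hf, hfe⟩ := exists_perturbation hU (e n) g' hg' (half_pos hr)
    refine ⟨f, ?_, ?_⟩
    · rw [Metric.mem_ball, dist_pi_lt_iff hr]
      intro i
      rw [dist_eq_norm]
      calc ‖f i - g i‖ = ‖(f i - g' i) + (g' i - g i)‖ := by congr 1; abel
        _ ≤ ‖f i - g' i‖ + ‖g' i - g i‖ := norm_add_le _ _
        _ < r := by linarith [hf i, hgg' i]
    · have hyc : y ∈ closure (orbitSpan U (Set.range f) : Set H) := hfe hy
      obtain ⟨z, hz, hzy⟩ := Metric.mem_closure_iff.1 hyc (ε - ‖y - h‖) (by linarith)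
      refine ⟨z, hz, ?_⟩
      rw [dist_eq_norm, norm_sub_rev] at hzy
      calc ‖z - h‖ = ‖(z - y) + (y - h)‖ := by congr 1; abel
        _ ≤ ‖z - y‖ + ‖y - h‖ := norm_add_le _ _
        _ < ε := by linarith
  obtain ⟨D, hDc, hD⟩ := TopologicalSpace.exists_countable_dense H
  have : Countable D := hDc.to_subtype
  obtain ⟨f, hf⟩ := (dense_iInter_of_isOpen
    (f := fun p : D × ℕ => {f : ι → H | ∃ y ∈ orbitSpan U (Set.range f),
      ‖y - p.1‖ < 1 / ((p.2 : ℝ) + 1)})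
    (fun p => hopen _ _) (fun p => hdense _ _ (by positivity))).nonempty
  have hgen : IsGenerating U (Set.range f) := by
    rw [isGenerating_iff]
    have hDK : D ⊆ ((orbitSpan U (Set.range f)).topologicalClosure : Set H) := by
      intro h hh
      refine Metric.mem_closure_iff.2 fun ε hε => ?_
      obtain ⟨m, hm⟩ := exists_nat_one_div_lt hε
      obtain ⟨y, hy, hyh⟩ := Set.mem_iInter.1 hf (⟨h, hh⟩, m)
      refine ⟨y, hy, ?_⟩
      rw [dist_eq_norm, norm_sub_rev]
      exact hyh.trans hm
    intro x
    exact closure_minimal hDK (Submodule.isClosed_topologicalClosure _) (hD x)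
  calc Mult U ≤ (Set.range f).encard := iInf₂_le _ hgen
    _ ≤ (Set.univ : Set ι).encard := by rw [← Set.image_univ]; exact Set.encard_image_le _ _
    _ = Fintype.card ι := by simp

end Hilbert
end Abstract

/-! ### Passage to mean-zero functions; singularity of ergodic measures -/

section KoopmanMult

open scoped InnerProductSpace

theorem map_orbitSpan_of_semiconj {E F : Type*} [NormedAddCommGroup E] [NormedSpace ℝ E]
    [NormedAddCommGroup F] [NormedSpace ℝ F] {U : E ≃L[ℝ] E} {V : F ≃L[ℝ] F} (P : E →L[ℝ] F)
    (hP : ∀ x, P (U x) = V (P x)) {ι : Type*} (e : ι → E) {y : E}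
    (hy : y ∈ orbitSpan U (Set.range e)) : P y ∈ orbitSpan V (Set.range fun i => P (e i)) := by
  have hP' : ∀ x, P (U.symm x) = V.symm (P x) := fun x => by
    rw [V.eq_symm_apply, ← hP, U.apply_symm_apply]
  have hz : ∀ (k : ℤ) (x : E), P ((U ^ k) x) = (V ^ k) (P x) := by
    intro k
    induction k using Int.induction_on with
    | zero => intro x; rfl
    | succ n ih =>
      intro x
      rw [zpow_add_one, zpow_add_one]
      change P ((U ^ (n : ℤ)) (U x)) = (V ^ (n : ℤ)) (V (P x))
      rw [ih, hP]
    | pred n ih =>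
      intro x
      rw [zpow_sub_one, zpow_sub_one]
      change P ((U ^ (-n : ℤ)) (U.symm x)) = (V ^ (-n : ℤ)) (V.symm (P x))
      rw [ih, hP']
  have : orbitSpan U (Set.range e) ≤
      (orbitSpan V (Set.range fun i => P (e i))).comap (P : E →ₗ[ℝ] F) := by
    refine orbitSpan_le U ?_
    rintro _ ⟨i, rfl⟩ k
    change P ((U ^ k) (e i)) ∈ orbitSpan V (Set.range fun i => P (e i))
    rw [hz]
    exact zpow_mem_orbitSpan V (Set.mem_range_self i) k
  exact this hy

variable {α : Type*} [MeasurableSpace α]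

theorem inner_koopman (T : α ≃ᵐ α) (μ : Measure α) (hT : MeasurePreserving T μ μ)
    (f g : Lp ℝ 2 μ) : ⟪koopman T μ hT f, koopman T μ hT g⟫_ℝ = ⟪f, g⟫_ℝ :=
  (Lp.compMeasurePreservingₗᵢ ℝ (p := 2) (E := ℝ) T hT).inner_map_map f g

theorem isClosed_L20 (μ : Measure α) [IsFiniteMeasure μ] : IsClosed (L20 μ : Set (Lp ℝ 2 μ)) := by
  have : L20 μ = (ℝ ∙ (indicatorConstLp 2 (μ := μ) MeasurableSet.univ
      (measure_ne_top μ _) (1 : ℝ)))ᗮ := by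
    ext f
    rw [Submodule.mem_orthogonal_singleton_iff_inner_right, L2.inner_indicatorConstLp_one,
      setIntegral_univ]
    rfl
  rw [this]
  exact Submodule.isClosed_orthogonal _

/-- Approximations in `L²` project to approximations in `L²₀`: the orthogonal projection is a
contraction and commutes with the Koopman operator. -/
theorem mult_koopman0_le (T : α ≃ᵐ α) (μ : Measure α) [IsFiniteMeasure μ]
    (hT : MeasurePreserving T μ μ) [SecondCountableTopology (Lp ℝ 2 μ)] {ι : Type*} [Fintype ι]
    {β : Type*} {l : Filter β} [l.NeBot] (e : β → ι → Lp ℝ 2 μ)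
    (he : ∀ h : Lp ℝ 2 μ, ∀ ε > 0, ∀ᶠ n in l,
      ∃ y ∈ orbitSpan (koopman T μ hT) (Set.range (e n)), ‖y - h‖ < ε) :
    Mult (koopman0 T μ hT) ≤ Fintype.card ι := by
  have : CompleteSpace (L20 μ) := (isClosed_L20 μ).completeSpace_coe
  have : SecondCountableTopology (L20 μ) :=
    inferInstanceAs (SecondCountableTopology (L20 μ : Set (Lp ℝ 2 μ)))
  set P := (L20 μ).orthogonalProjectionOnto
  have hK' : ∀ x ∈ L20 μ, (koopman T μ hT).symm x ∈ L20 μ := fun x hx =>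
    ((koopman0 T μ hT).symm ⟨x, hx⟩).2
  have hP : ∀ x, P (koopman T μ hT x) = koopman0 T μ hT (P x) := by
    intro x
    have h1 : (koopman T μ hT (P x) : Lp ℝ 2 μ) ∈ L20 μ := (koopman0 T μ hT (P x)).2
    have h2 : koopman T μ hT x - koopman T μ hT (P x) ∈ (L20 μ)ᗮ := by
      rw [← map_sub]
      refine map_orthogonal (inner_koopman T μ hT) hK' _ ?_
      exact Submodule.sub_starProjection_mem_orthogonal x
    exact Subtype.ext (Submodule.eq_starProjection_of_mem_orthogonal h1 h2)
  refine mult_le_of_approx (U := koopman0 T μ hT) (l := l)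
    (fun x y => inner_koopman T μ hT x.1 y.1) (fun n i => P (e n i)) fun h ε hε => ?_
  filter_upwards [he h ε hε] with n hn
  obtain ⟨y, hy, hyh⟩ := hn
  refine ⟨P y, map_orbitSpan_of_semiconj P hP (e n) hy, ?_⟩
  have hh : P h = h := Submodule.orthogonalProjectionOnto_mem_subspace_eq_self h
  calc ‖P y - h‖ = ‖P (y - h)‖ := by rw [map_sub, hh]
    _ ≤ ‖P‖ * ‖y - h‖ := P.le_opNorm _
    _ ≤ 1 * ‖y - h‖ := by
      gcongr
      exact Submodule.orthogonalProjectionOnto_norm_le _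
    _ < ε := by rwa [one_mul]

/-- The singular part of `ν` is invariant and absolutely continuous with respect to `ν`, hence
equals `c • ν`. If `c = 0` then `ν ≪ μ`, which forces equality; otherwise `ν` is itself singular. -/
theorem mutuallySingular_of_ergodic {T : α → α} {μ ν : Measure α} [IsProbabilityMeasure μ]
    [IsProbabilityMeasure ν] (hμ : Ergodic T μ) (hν : Ergodic T ν) (h : μ ≠ ν) : ν ⟂ₘ μ := by
  have hs := hν.toMeasurePreserving.singularPart hμ.toMeasurePreserving
  obtain ⟨c, hc⟩ := hν.eq_smul_of_absolutelyContinuous hs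
    (Measure.absolutelyContinuous_of_le (Measure.singularPart_le ν μ))
  rcases eq_or_ne c 0 with rfl | hc0
  · rw [zero_smul, Measure.singularPart_eq_zero] at hc
    exact absurd (hμ.eq_of_absolutelyContinuous hν.toMeasurePreserving hc).symm h
  · have := Measure.mutuallySingular_singularPart ν μ
    rw [hc] at this
    exact this.mono_ac (Measure.absolutelyContinuous_smul hc0) Measure.AbsolutelyContinuous.rfl

end KoopmanMult

/-! ### Right special words and the tower partition -/

section Towers

open SymbolicDynamics.FullShift

variable {A : Type*} [TopologicalSpace A]

/-- The action of `k ∈ ℤ` by the `k`-th power of the shift on a subshift. -/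
def shiftMap (X : Subshift A ℤ) (k : ℤ) : C(X.carrier, X.carrier) where
  toFun x := ⟨shift k x.1, X.mapsTo k x.2⟩
  continuous_toFun := by fun_prop

@[simp] theorem shiftMap_apply {X : Subshift A ℤ} (k : ℤ) (x : X.carrier) (m : ℤ) :
    (shiftMap X k x).1 m = x.1 (k + m) := rfl

theorem shiftMap_shiftMap {X : Subshift A ℤ} (k l : ℤ) (x : X.carrier) :
    shiftMap X k (shiftMap X l x) = shiftMap X (l + k) x := by
  ext m
  simp [add_assoc]

@[simp] theorem shiftMap_zero {X : Subshift A ℤ} (x : X.carrier) : shiftMap X 0 x = x := by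
  ext m
  simp

/-- The word `x_0 ⋯ x_{n-1}`. -/
def word {X : Subshift A ℤ} (n : ℕ) (x : X.carrier) : Fin n → A := fun i => x.1 (i : ℕ)

theorem word_mem {X : Subshift A ℤ} (n : ℕ) (x : X.carrier) : word n x ∈ words X n :=
  ⟨x.1, x.2, 0, fun i => by simp [word]⟩

/-- The words `w a` of length `n + 1` of `X` such that `w b` is a word of `X` for some `b ≠ a`. -/
def specialWords (X : Subshift A ℤ) (n : ℕ) : Set (Fin (n + 1) → A) :=
  {u | u ∈ words X (n + 1) ∧ ∃ v ∈ words X (n + 1), Fin.init v = Fin.init u ∧ v ≠ u}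

/-- The points `x` such that `x_0 ⋯ x_{n-1}` is a right special word. -/
def IsSpecialAt {X : Subshift A ℤ} (n : ℕ) (x : X.carrier) : Prop :=
  word (n + 1) x ∈ specialWords X n

theorem init_word {X : Subshift A ℤ} (n : ℕ) (x : X.carrier) :
    Fin.init (word (n + 1) x) = word n x := by
  ext i
  simp [Fin.init, word]

theorem eq_of_not_isSpecialAt {X : Subshift A ℤ} {n : ℕ} {x y : X.carrier}
    (h : ¬ IsSpecialAt n x) (hxy : word n x = word n y) : word (n + 1) x = word (n + 1) y := by
  by_contra hne
  exact h ⟨word_mem _ x, word (n + 1) y, word_mem _ y, by rw [init_word, init_word, hxy],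
    Ne.symm hne⟩

/-- Although `IsSpecialAt` reads `n + 1` letters, it depends only on the first `n`. -/
theorem IsSpecialAt.congr {X : Subshift A ℤ} {n : ℕ} {x y : X.carrier} (h : IsSpecialAt n x)
    (hxy : word n x = word n y) : IsSpecialAt n y := by
  by_contra hy
  have := eq_of_not_isSpecialAt hy hxy.symm
  unfold IsSpecialAt at h hy
  rw [this] at hy
  exact hy h

theorem word_eq_iff {X : Subshift A ℤ} {n : ℕ} {x y : X.carrier} :
    word n x = word n y ↔ ∀ m : ℕ, m < n → x.1 m = y.1 m := by
  constructor
  · intro h m hm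
    exact congrFun h ⟨m, hm⟩
  · intro h
    ext i
    exact h i i.2

/-- If the right half of `x` had period `p`, the shifts of `x` by `j * p` would converge to a
periodic point, which lies in the closed set `X`. -/
theorem not_eventually_periodic [T2Space A] {X : Subshift A ℤ} (hX : IsAperiodic X)
    (x : X.carrier) {p : ℕ} (hp : 0 < p) : ∃ m : ℕ, x.1 m ≠ x.1 (m + p : ℕ) := by
  by_contra! h
  have h1 : ∀ (j m : ℕ), x.1 m = x.1 (m + j * p : ℕ) := by
    intro j
    induction j with
    | zero => simp
    | succ j ih => 
      intro m
      rw [ih, h, show m + (j + 1) * p = m + j * p + p by ring]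
  let y : ℤ → A := fun i => x.1 (i % p)
  have hp' : (p : ℤ) ≠ 0 := by exact_mod_cast hp.ne'
  have h2 : ∀ i : ℤ, 0 ≤ i → x.1 i = y i := by
    intro i hi
    lift i to ℕ using hi
    have := h1 (i / p) (i % p)
    rw [mul_comm, Nat.mod_add_div] at this
    rw [← this]
    simp [y]
  have hy : y ∈ X.carrier := by
    refine X.isClosed.mem_of_tendsto (b := atTop)
      (f := fun j : ℕ => shift ((j * p : ℕ) : ℤ) x.1) ?_
      (Eventually.of_forall fun j => X.mapsTo _ x.2)
    rw [tendsto_pi_nhds]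
    intro i
    refine tendsto_const_nhds.congr' ?_
    filter_upwards [eventually_ge_atTop i.natAbs] with j hj
    have hjp : (j : ℤ) ≤ j * p := by
      have : (1 : ℤ) ≤ p := by exact_mod_cast hp
      nlinarith
    rw [shift_apply, h2 _ (by push_cast; omega)]
    simp [y]
  exact hX y hy p hp (by ext i; simp [y])

/-- By pigeonhole some word of length `n` repeats within `M` steps; without a special word on the
way all later letters are forced and the point is eventually periodic. Uniformity of `M` also gives
visits in the past. -/
theorem exists_isSpecialAt [Finite A] [T2Space A] {X : Subshift A ℤ} (hX : IsAperiodic X) (n : ℕ) :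
    ∃ M : ℕ, ∀ x : X.carrier, ∃ m : ℕ, m ≤ M ∧ IsSpecialAt n (shiftMap X m x) := by
  classical
  have := Fintype.ofFinite A
  refine ⟨Fintype.card (Fin n → A), fun x => ?_⟩
  by_contra! hcon
  set M := Fintype.card (Fin n → A)
  obtain ⟨a, b, hab, heq⟩ := Fintype.exists_ne_map_eq_of_card_lt
    (fun m : Fin (M + 1) => word n (shiftMap X (m : ℕ) x)) (by simp [M])
  wlog hlt : (a : ℕ) < b generalizing a b
  · exact this b a hab.symm heq.symm (by omega)
  obtain ⟨p, hp⟩ := Nat.exists_eq_add_of_lt hlt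
  have hb : (b : ℕ) ≤ M := by omega
  -- Non-speciality propagates with the equality: beyond time `b`, the word at `a + m` already
  -- occurred `b - a` steps earlier.
  have key : ∀ m : ℕ, word n (shiftMap X (a + m : ℕ) x) = word n (shiftMap X (b + m : ℕ) x) ∧
      ¬ IsSpecialAt n (shiftMap X (a + m : ℕ) x) := by
    intro m
    induction m using Nat.strong_induction_on with
    | _ m ih =>
      refine ⟨?_, ?_⟩
      · rcases Nat.eq_zero_or_pos m with rfl | hm
        · exact heq
        · obtain ⟨h1, h2⟩ := ih (m - 1) (by omega)
          have h3 := word_eq_iff.1 (eq_of_not_isSpecialAt h2 h1)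
          refine word_eq_iff.2 fun i hi => ?_
          have := h3 (i + 1) (by omega)
          simp only [shiftMap_apply] at this ⊢
          convert! this using 2 <;> push_cast [Nat.cast_sub hm] <;> ring
      · by_cases hm : a + m < b
        · exact hcon _ (by omega)
        · obtain ⟨h1, h2⟩ := ih (a + m - b) (by omega)
          have : (b + (a + m - b) : ℕ) = a + m := by omega
          rw [this] at h1
          exact fun h => h2 (h.congr h1.symm)
  obtain ⟨m, hm⟩ := not_eventually_periodic hX (shiftMap X (a + n : ℕ) x) (Nat.succ_pos p)
  apply hm
  have := word_eq_iff.1 (eq_of_not_isSpecialAt (key m).2 (key m).1) n (Nat.lt_succ_self n)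
  simp only [shiftMap_apply] at this ⊢
  convert! this using 2
  · push_cast; ring
  · rw [hp]; push_cast; ring

/-- Fibre over words of length `n`. Each has `d ≥ 1` extensions: if `d ≥ 2`, the special ones number
at most `d ≤ 2(d-1)`; if `d = 1`, there are none. -/
theorem ncard_specialWords [Finite A] (X : Subshift A ℤ) (n : ℕ) :
    (specialWords X n).ncard + 2 * complexity X n ≤ 2 * complexity X (n + 1) := by
  classical
  have := Fintype.ofFinite A
  set V := (words X n).toFinset
  set W := (words X (n + 1)).toFinset
  have hinit : ∀ u ∈ W, Fin.init u ∈ V := by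
    intro u hu
    obtain ⟨x, hx, m, hu⟩ := Set.mem_toFinset.1 hu
    exact Set.mem_toFinset.2 ⟨x, hx, m, fun i => by simp [Fin.init, hu]⟩
  have hS : (specialWords X n).ncard =
      (W.filter fun u => u ∈ specialWords X n).card := by
    rw [← Set.ncard_coe_finset]
    congr 1
    ext u
    simp only [Finset.coe_filter, Set.mem_ofPred_eq, W, Set.mem_toFinset]
    exact ⟨fun h => ⟨h.1, h⟩, fun h => h.2⟩
  have hSinit : ∀ u ∈ W.filter (fun u => u ∈ specialWords X n), Fin.init u ∈ V :=
    fun u hu => hinit u (Finset.mem_filter.1 hu).1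
  rw [hS, complexity, complexity, Set.ncard_eq_toFinset_card', Set.ncard_eq_toFinset_card',
    Finset.card_eq_sum_card_fiberwise hSinit, Finset.card_eq_sum_card_fiberwise hinit,
    Finset.card_eq_sum_ones, Finset.mul_sum, Finset.mul_sum, ← Finset.sum_add_distrib]
  refine Finset.sum_le_sum fun w hw => ?_
  rw [mul_one]
  have hne : ∃ u ∈ W, Fin.init u = w := by
    obtain ⟨x, hx, m, hu⟩ := Set.mem_toFinset.1 hw
    refine ⟨fun i => x (m + (i : ℕ)), Set.mem_toFinset.2 ⟨x, hx, m, fun i => rfl⟩, ?_⟩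
    ext i
    simp [Fin.init, hu]
  by_cases h2 : 2 ≤ (W.filter fun u => Fin.init u = w).card
  · have : ((W.filter fun u => u ∈ specialWords X n).filter fun u => Fin.init u = w).card ≤
        (W.filter fun u => Fin.init u = w).card :=
      Finset.card_le_card (Finset.filter_subset_filter _ (Finset.filter_subset _ _))
    omega
  · have h0 : (W.filter fun u => u ∈ specialWords X n).filter (fun u => Fin.init u = w) = ∅ := by
      rw [Finset.eq_empty_iff_forall_notMem]
      intro u hu
      simp only [Finset.mem_filter] at hu
      obtain ⟨⟨huW, -, v, hv, hvu, hne⟩, huw⟩ := hu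
      apply h2
      rw [← Nat.lt_iff_add_one_le, Finset.one_lt_card]
      exact ⟨u, by simp [huW, huw], v, by simp [W, hv, hvu, huw], hne.symm⟩
    obtain ⟨u, hu, huw⟩ := hne
    have : 0 < (W.filter fun u => Fin.init u = w).card :=
      Finset.card_pos.2 ⟨u, by simp [hu, huw]⟩
    rw [h0, Finset.card_empty]
    omega

/-- Otherwise the complexity eventually grows by at least `k + 1` at each step. -/
theorem frequently_complexity_succ_le {X : Subshift A ℤ} {k : ℕ}
    (hk : liminf (fun n : ℕ => (complexity X n : ℝ≥0∞) / (n : ℝ≥0∞)) atTop ≤ (k : ℝ≥0∞)) :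
    ∃ᶠ n in atTop, complexity X (n + 1) ≤ complexity X n + k := by
  intro hcon
  obtain ⟨N, hN⟩ := eventually_atTop.1 hcon
  have h1 : ∀ j : ℕ, (k + 1) * j ≤ complexity X (N + j) := by
    intro j
    induction j with
    | zero => simp
    | succ j ih =>
      have := hN (N + j) (by omega)
      rw [← add_assoc]
      rw [mul_add]
      omega
  have h2 : ∀ᶠ n : ℕ in atTop, ((k + 1 / 2 : NNReal) : ℝ≥0∞) ≤ (complexity X n : ℝ≥0∞) / n := by
    -- This threshold makes `(k + 1) * N ≤ n / 2`, whence `(k + 1) * (n - N) ≥ (k + 1/2) * n`.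
    filter_upwards [eventually_ge_atTop (2 * (k + 1) * N + 1)] with n hn
    have hn0 : 0 < n := by omega
    rw [ENNReal.le_div_iff_mul_le (by simp [hn0.ne']) (by simp)]
    have hNn : N ≤ n := by nlinarith
    have h3 := h1 (n - N)
    rw [Nat.add_sub_cancel' hNn] at h3
    have h4 : ((k : NNReal) + 1 / 2) * n ≤ complexity X n := by
      have h5 : ((k : ℝ) + 1) * (n - N) ≤ complexity X n := by
        have : (((k + 1) * (n - N) : ℕ) : ℝ) ≤ complexity X n := by exact_mod_cast h3
        push_cast [Nat.cast_sub hNn] at this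
        exact this
      have h6 : (2 * ((k : ℝ) + 1) * N + 1) ≤ n := by exact_mod_cast hn
      rw [← NNReal.coe_le_coe]
      push_cast
      linarith
    exact_mod_cast h4
  have h3 := (le_liminf_of_le (by isBoundedDefault) h2).trans hk
  have h4 : ((k : NNReal) + 1 / 2) ≤ k := by exact_mod_cast h3
  have h5 : ((k : ℝ) + 1 / 2) ≤ k := by exact_mod_cast h4
  linarith

/-- The time of the first visit after `0` to the right special words. -/
theorem exists_return [Finite A] [T2Space A] {X : Subshift A ℤ} (hX : IsAperiodic X) (n : ℕ)
    (x : X.carrier) : ∃ r : ℕ, 0 < r ∧ IsSpecialAt n (shiftMap X r x) ∧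
      ∀ m : ℕ, 0 < m → m < r → ¬ IsSpecialAt n (shiftMap X m x) := by
  classical
  have h : ∃ r : ℕ, 0 < r ∧ IsSpecialAt n (shiftMap X r x) := by
    obtain ⟨M, hM⟩ := exists_isSpecialAt hX n
    obtain ⟨m, -, hm⟩ := hM (shiftMap X 1 x)
    refine ⟨m + 1, by omega, ?_⟩
    rwa [shiftMap_shiftMap, add_comm] at hm
  exact ⟨Nat.find h, (Nat.find_spec h).1, (Nat.find_spec h).2,
    fun m hm hmr hs => Nat.find_min h hmr ⟨hm, hs⟩⟩

/-- The initial `n + 1` letters settle the choice at time 0; at times `1, …, r - 1` the next letter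
is forced. The last one has index `r - 1 + n`. -/
theorem agree_until_return {X : Subshift A ℤ} {n r : ℕ} {x y : X.carrier}
    (hxy : word (n + 1) x = word (n + 1) y)
    (hr : ∀ m : ℕ, 0 < m → m < r → ¬ IsSpecialAt n (shiftMap X m x)) :
    ∀ m : ℕ, m < r + n → x.1 m = y.1 m := by
  have key : ∀ j : ℕ, j < r → word (n + 1 + j) x = word (n + 1 + j) y := by
    intro j
    induction j with
    | zero => intro _; exact hxy
    | succ j ih =>
      intro hj
      have h1 := word_eq_iff.1 (ih (by omega))
      have h2 : word n (shiftMap X (j + 1 : ℕ) x) = word n (shiftMap X (j + 1 : ℕ) y) := by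
        refine word_eq_iff.2 fun m hm => ?_
        simp only [shiftMap_apply]
        exact_mod_cast h1 (j + 1 + m) (by omega)
      have h3 := word_eq_iff.1 (eq_of_not_isSpecialAt (hr _ (by omega) hj) h2) n (by omega)
      refine word_eq_iff.2 fun m hm => ?_
      rcases Nat.lt_or_ge m (n + 1 + j) with h | h
      · exact h1 m h
      · obtain rfl : m = j + 1 + n := by omega
        simpa using h3
  intro m hm
  rcases Nat.eq_zero_or_pos r with rfl | hr0
  · exact word_eq_iff.1 hxy m (by omega)
  · exact word_eq_iff.1 (key (r - 1) (by omega)) m (by omega)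

/-- The right special word that `x` sees at time `r` lies in the range where `x` and `y` agree. By
symmetry, return times are constant on each base. -/
theorem return_le {X : Subshift A ℤ} {n r s : ℕ} {x y : X.carrier}
    (hxy : word (n + 1) x = word (n + 1) y) (hr0 : 0 < r)
    (hr : ∀ m : ℕ, 0 < m → m < r → ¬ IsSpecialAt n (shiftMap X m x))
    (hrx : IsSpecialAt n (shiftMap X r x))
    (hs : ∀ m : ℕ, 0 < m → m < s → ¬ IsSpecialAt n (shiftMap X m y)) : s ≤ r := by
  by_contra! hlt
  refine hs r hr0 hlt (hrx.congr (word_eq_iff.2 fun m hm => ?_))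
  simp only [shiftMap_apply]
  exact_mod_cast agree_until_return hxy hr (r + m) (by omega)

/-- A subshift of complexity with `p(n + 1) ≤ p(n) + k` is partitioned into at most `2 * k` towers
over the cylinders of the special words of length `n + 1`. -/
theorem exists_towers_of_complexity_le [Finite A] [DiscreteTopology A] {X : Subshift A ℤ}
    (hX : IsAperiodic X) {n k : ℕ} (hn : complexity X (n + 1) ≤ complexity X n + k) :
    ∃ (ψ : Fin (2 * k) → C(X.carrier, ℝ)) (h : Fin (2 * k) → ℕ),
      (∀ i x, ψ i x = 0 ∨ ψ i x = 1) ∧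
      (∀ x, ∑ i, ∑ j ∈ Finset.range (h i), ψ i (shiftMap X (-j : ℤ) x) = 1) ∧
      ∀ i x y, ψ i x = 1 → ψ i y = 1 → ∀ m : ℕ, m < h i + n → x.1 m = y.1 m := by
  classical
  have hcard : (specialWords X n).ncard ≤ 2 * k := by
    have := ncard_specialWords X n
    omega
  have : Fintype (specialWords X n) := Fintype.ofFinite _
  obtain ⟨c⟩ : Nonempty (specialWords X n ↪ Fin (2 * k)) := by
    apply Function.Embedding.nonempty_of_card_le
    rwa [Fintype.card_fin, ← Nat.card_eq_fintype_card]
  let g : Fin (2 * k) → (Fin (n + 1) → A) → ℝ := fun i u =>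
    if ∃ hu : u ∈ specialWords X n, c ⟨u, hu⟩ = i then 1 else 0
  let ψ : Fin (2 * k) → C(X.carrier, ℝ) := fun i =>
    ⟨fun x => g i (word (n + 1) x), by
      refine (continuous_of_discreteTopology (f := g i)).comp (continuous_pi fun j => ?_)
      exact (continuous_apply ((j : ℕ) : ℤ)).comp continuous_subtype_val⟩
  have hψ : ∀ i x, ψ i x = 1 ↔ ∃ hx : IsSpecialAt n x, c ⟨word (n + 1) x, hx⟩ = i := by
    intro i x
    change g i (word (n + 1) x) = 1 ↔ _
    simp only [g]
    split_ifs with h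
    · exact ⟨fun _ => h, fun _ => rfl⟩
    · exact ⟨fun h' => by norm_num at h', fun h' => absurd h' h⟩
  have hψ01 : ∀ i x, ψ i x = 0 ∨ ψ i x = 1 := by
    intro i x
    change g i (word (n + 1) x) = 0 ∨ g i (word (n + 1) x) = 1
    simp only [g]
    split_ifs <;> simp
  have hword : ∀ i x y, ψ i x = 1 → ψ i y = 1 → word (n + 1) x = word (n + 1) y := by
    intro i x y hx hy
    obtain ⟨hx, hx'⟩ := (hψ i x).1 hx
    obtain ⟨hy, hy'⟩ := (hψ i y).1 hy
    exact congrArg Subtype.val (c.injective (hx'.trans hy'.symm))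
  choose r hr0 hrs hr using exists_return hX n
  have hreq : ∀ i x y, ψ i x = 1 → ψ i y = 1 → r x = r y := fun i x y hx hy =>
    le_antisymm
      (return_le (hword i y x hy hx) (hr0 y) (hr y) (hrs y) (hr x))
      (return_le (hword i x y hx hy) (hr0 x) (hr x) (hrs x) (hr y))
  have hh : ∀ i, ∃ h : ℕ, ∀ x, ψ i x = 1 → r x = h := by
    intro i
    by_cases hi : ∃ x, ψ i x = 1
    · obtain ⟨x, hx⟩ := hi
      exact ⟨r x, fun y hy => hreq i y x hy hx⟩
    -- An empty base gets height 0.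
    · exact ⟨0, fun x hx => absurd ⟨x, hx⟩ hi⟩
  choose h hh using hh
  refine ⟨ψ, h, hψ01, fun x => ?_, fun i x y hx hy => ?_⟩
  -- The latest special visit at a time `-j₀ ≤ 0` determines the unique tower and level containing
  -- `x`.
  · have hex : ∃ j : ℕ, IsSpecialAt n (shiftMap X (-j : ℤ) x) := by
      obtain ⟨M, hM⟩ := exists_isSpecialAt hX n
      obtain ⟨m, hmM, hm⟩ := hM (shiftMap X (-M : ℤ) x)
      refine ⟨M - m, ?_⟩
      rw [shiftMap_shiftMap] at hm
      convert! hm using 2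
      push_cast [Nat.cast_sub hmM]
      ring_nf
    set j₀ := Nat.find hex
    have hj₀ : IsSpecialAt n (shiftMap X (-j₀ : ℤ) x) := Nat.find_spec hex
    set i₀ := c ⟨_, hj₀⟩
    have hψ₀ : ψ i₀ (shiftMap X (-j₀ : ℤ) x) = 1 := (hψ _ _).2 ⟨hj₀, rfl⟩
    have hj₀h : j₀ < h i₀ := by
      rw [← hh _ _ hψ₀]
      by_contra! hle
      have h1 := hrs (shiftMap X (-j₀ : ℤ) x)
      have h0 := hr0 (shiftMap X (-j₀ : ℤ) x)
      set q := r (shiftMap X (-j₀ : ℤ) x)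
      -- If `q ≤ j₀`, the return would be a more recent visit still in the past or present.
      refine Nat.find_min hex (m := j₀ - q) (by omega) ?_
      rw [shiftMap_shiftMap] at h1
      convert! h1 using 2
      push_cast [Nat.cast_sub hle]
      ring_nf
    have huniq : ∀ i j, j < h i → ψ i (shiftMap X (-j : ℤ) x) = 1 → j = j₀ ∧ i = i₀ := by
      intro i j hj hij
      obtain ⟨hs, hc⟩ := (hψ _ _).1 hij
      have hle : j₀ ≤ j := Nat.find_min' hex hs
      have hjj : j = j₀ := by
        by_contra hne
        rw [← hh _ _ hij] at hj
        refine hr (shiftMap X (-j : ℤ) x) (j - j₀) (by omega) (by omega) ?_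
        rw [shiftMap_shiftMap]
        convert! hj₀ using 2
        push_cast [Nat.cast_sub hle]
        ring_nf
      subst hjj
      exact ⟨rfl, hc.symm⟩
    rw [Finset.sum_eq_single i₀, Finset.sum_eq_single j₀, hψ₀]
    · intro j hj hne
      refine (hψ01 _ _).resolve_right fun h1 => hne (huniq _ _ (Finset.mem_range.1 hj) h1).1
    · intro hj
      exact absurd (Finset.mem_range.2 hj₀h) hj
    · intro i _ hne
      refine Finset.sum_eq_zero fun j hj => ?_
      exact (hψ01 _ _).resolve_right fun h1 => hne (huniq _ _ (Finset.mem_range.1 hj) h1).2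
    · simp
  · rw [← hh i x hx]
    exact agree_until_return (hword i x y hx hy) (hr x)

theorem exists_towers [Finite A] [DiscreteTopology A] {X : Subshift A ℤ}
    (hX : IsAperiodic X) {k : ℕ}
    (hk : liminf (fun n : ℕ => (complexity X n : ℝ≥0∞) / (n : ℝ≥0∞)) atTop ≤ (k : ℝ≥0∞))
    (l : ℕ) :
    ∃ (ψ : Fin (2 * k) → C(X.carrier, ℝ)) (h : Fin (2 * k) → ℕ),
      (∀ i x, ψ i x = 0 ∨ ψ i x = 1) ∧
      (∀ x, ∑ i, ∑ j ∈ Finset.range (h i), ψ i (shiftMap X (-j : ℤ) x) = 1) ∧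
      ∀ i x y, ψ i x = 1 → ψ i y = 1 → ∀ m : ℕ, m < h i + l → x.1 m = y.1 m := by
  obtain ⟨n, hn, hln⟩ :=
    ((frequently_complexity_succ_le hk).and_eventually (eventually_ge_atTop l)).exists
  obtain ⟨ψ, h, h1, h2, h3⟩ := exists_towers_of_complexity_le hX hn
  exact ⟨ψ, h, h1, h2, fun i x y hx hy m hm => h3 i x y hx hy m (by omega)⟩

end Towers

/-! ### Cylinder functions, generation of `L²` by towers, and separation of measures -/

section Measures

open SymbolicDynamics.FullShift

variable {A : Type*} [TopologicalSpace A]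

theorem comp_shiftMap_congr {X : Subshift A ℤ} {g : C(X.carrier, ℝ)} {q : ℕ}
    (hg : ∀ x y : X.carrier, (∀ m : ℤ, -q ≤ m → m < q → x.1 m = y.1 m) → g x = g y)
    (x y : X.carrier) (hxy : ∀ m : ℕ, m < 2 * q → x.1 m = y.1 m) :
    g.comp (shiftMap X q) x = g.comp (shiftMap X q) y := by
  refine hg _ _ fun m h1 h2 => ?_
  simp only [shiftMap_apply]
  have := hxy (q + m).toNat (by omega)
  rwa [Int.toNat_of_nonneg (by omega)] at this

/-- On each level of a tower, a function of few coordinates is constant. -/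
theorem exists_level_const {X : Subshift A ℤ} {ψ : C(X.carrier, ℝ)} {h l n : ℕ}
    (hψ01 : ∀ x, ψ x = 0 ∨ ψ x = 1)
    (hψ : ∀ x y, ψ x = 1 → ψ y = 1 → ∀ m : ℕ, m < h + l → x.1 m = y.1 m)
    {G : C(X.carrier, ℝ)} (hG : ∀ x y : X.carrier, (∀ m : ℕ, m < n → x.1 m = y.1 m) → G x = G y)
    (hn : n ≤ l) : ∃ a : ℕ → ℝ, ∀ j ∈ Finset.range h, ∀ x,
      G x * ψ (shiftMap X (-j : ℤ) x) = a j * ψ (shiftMap X (-j : ℤ) x) := by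
  have : ∀ j : ℕ, ∃ a : ℝ, j ∈ Finset.range h → ∀ x,
      G x * ψ (shiftMap X (-j : ℤ) x) = a * ψ (shiftMap X (-j : ℤ) x) := by
    intro j
    by_cases hex : ∃ y, ψ (shiftMap X (-j : ℤ) y) = 1
    · obtain ⟨y, hy⟩ := hex
      refine ⟨G y, fun hj x => ?_⟩
      rw [Finset.mem_range] at hj
      rcases hψ01 (shiftMap X (-j : ℤ) x) with h0 | h1
      · rw [h0, mul_zero, mul_zero]
      · rw [hG x y fun m hm => ?_]
        -- Coordinate `m` of a point on level `j < h` is coordinate `j + m < h + l` of its base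
        -- point.
        have := hψ _ _ h1 hy (j + m) (by omega)
        simpa using this
    · push Not at hex
      refine ⟨0, fun _ x => ?_⟩
      rw [(hψ01 (shiftMap X (-j : ℤ) x)).resolve_right (hex x), mul_zero, mul_zero]
  choose a ha using this
  exact ⟨a, fun j hj => ha j hj⟩

variable [Finite A] [DiscreteTopology A]

instance instCompactSpaceCarrier (X : Subshift A ℤ) : CompactSpace X.carrier :=
  isCompact_iff_compactSpace.1 X.isClosed.isCompact

/-- Continuous functions of finitely many coordinates are dense. -/
theorem exists_cylinder_function {X : Subshift A ℤ} (f : C(X.carrier, ℝ)) {ε : ℝ} (hε : 0 < ε) :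
    ∃ (g : C(X.carrier, ℝ)) (q : ℕ),
      (∀ x y : X.carrier, (∀ m : ℤ, -q ≤ m → m < q → x.1 m = y.1 m) → g x = g y) ∧
      ‖g - f‖ < ε := by
  classical
  let S : Subalgebra ℝ C(X.carrier, ℝ) :=
    { carrier := {g | ∃ q : ℕ, ∀ x y : X.carrier,
        (∀ m : ℤ, -q ≤ m → m < q → x.1 m = y.1 m) → g x = g y}
      mul_mem' := by
        rintro a b ⟨q, hq⟩ ⟨r, hr⟩
        refine ⟨max q r, fun x y h => ?_⟩
        rw [ContinuousMap.mul_apply, ContinuousMap.mul_apply,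
          hq x y fun m h1 h2 => h m (by push_cast; omega) (by push_cast; omega),
          hr x y fun m h1 h2 => h m (by push_cast; omega) (by push_cast; omega)]
      add_mem' := by
        rintro a b ⟨q, hq⟩ ⟨r, hr⟩
        refine ⟨max q r, fun x y h => ?_⟩
        rw [ContinuousMap.add_apply, ContinuousMap.add_apply,
          hq x y fun m h1 h2 => h m (by push_cast; omega) (by push_cast; omega),
          hr x y fun m h1 h2 => h m (by push_cast; omega) (by push_cast; omega)]
      algebraMap_mem' := fun r => ⟨0, fun x y _ => rfl⟩ }
  have hS : S.SeparatesPoints := by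
    intro x y hxy
    obtain ⟨m, hm⟩ : ∃ m : ℤ, x.1 m ≠ y.1 m := by
      by_contra! h
      exact hxy (Subtype.ext (funext h))
    let χ : A → ℝ := fun a => if a = x.1 m then 1 else 0
    let g : C(X.carrier, ℝ) := ⟨fun z => χ (z.1 m),
      (continuous_of_discreteTopology (f := χ)).comp
        ((continuous_apply m).comp continuous_subtype_val)⟩
    refine ⟨g, ⟨g, ⟨m.natAbs + 1, fun z w h => ?_⟩, rfl⟩, ?_⟩
    · change χ (z.1 m) = χ (w.1 m)
      rw [h m (by omega) (by omega)]
    · change χ (x.1 m) ≠ χ (y.1 m)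
      simp [χ, hm.symm]
  have hf : f ∈ closure (S : Set C(X.carrier, ℝ)) := by
    have := ContinuousMap.subalgebra_topologicalClosure_eq_top_of_separatesPoints S hS
    rw [← Subalgebra.topologicalClosure_coe, this]
    trivial
  obtain ⟨g, ⟨q, hq⟩, hg⟩ := Metric.mem_closure_iff.1 hf ε hε
  refine ⟨g, q, hq, ?_⟩
  rwa [dist_comm, dist_eq_norm] at hg

variable [MeasurableSpace A] [BorelSpace A]

theorem measurePreserving_shiftMap {X : Subshift A ℤ} {μ : Measure X.carrier}
    (hμ : MeasurePreserving (sigma X) μ μ) (k : ℤ) : MeasurePreserving (shiftMap X k) μ μ := by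
  have hμ' : MeasurePreserving (sigma X).symm μ μ :=
    MeasurePreserving.symm (sigma X).toMeasurableEquiv hμ
  induction k using Int.induction_on with
  | zero =>
    have : (shiftMap X 0 : X.carrier → X.carrier) = id := funext shiftMap_zero
    rw [this]
    exact MeasurePreserving.id μ
  | succ n ih =>
    have : (shiftMap X (n + 1) : X.carrier → X.carrier) = sigma X ∘ shiftMap X n :=
      funext fun x => (shiftMap_shiftMap 1 (n : ℤ) x).symm
    rw [this]
    exact hμ.comp ih
  | pred n ih =>
    have : (shiftMap X (-n - 1) : X.carrier → X.carrier) = (sigma X).symm ∘ shiftMap X (-n) :=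
      funext fun x => (shiftMap_shiftMap (-1) (-n : ℤ) x).symm
    rw [this]
    exact hμ'.comp ih

theorem integral_comp_shiftMap {X : Subshift A ℤ} {μ : Measure X.carrier}
    (hμ : MeasurePreserving (sigma X) μ μ) (k : ℤ) (f : X.carrier → ℝ) (hf : Continuous f) :
    ∫ x, f (shiftMap X k x) ∂μ = ∫ x, f x ∂μ := by
  have h := measurePreserving_shiftMap hμ k
  rw [← integral_map (f := f) h.measurable.aemeasurable
    (by rw [h.map_eq]; exact hf.aestronglyMeasurable), h.map_eq]

theorem koopman_zpow_toLp {X : Subshift A ℤ} {μ : Measure X.carrier} [IsFiniteMeasure μ]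
    (hμ : MeasurePreserving (sigma X).toMeasurableEquiv μ μ) (k : ℤ) (f : C(X.carrier, ℝ)) :
    (koopman (sigma X).toMeasurableEquiv μ hμ ^ k) (ContinuousMap.toLp 2 μ ℝ f) =
      ContinuousMap.toLp 2 μ ℝ (f.comp (shiftMap X k)) := by
  have h1 : ∀ f : C(X.carrier, ℝ), koopman (sigma X).toMeasurableEquiv μ hμ
      (ContinuousMap.toLp 2 μ ℝ f) = ContinuousMap.toLp 2 μ ℝ (f.comp (shiftMap X 1)) := by
    intro f
    refine Lp.ext ?_
    refine (Lp.coeFn_compMeasurePreserving _ hμ).trans ?_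
    refine (hμ.quasiMeasurePreserving.ae_eq_comp
      (ContinuousMap.coeFn_toLp (p := 2) (𝕜 := ℝ) μ f)).trans ?_
    exact (ContinuousMap.coeFn_toLp (p := 2) (𝕜 := ℝ) μ (f.comp (shiftMap X 1))).symm
  have h2 : ∀ f : C(X.carrier, ℝ), (koopman (sigma X).toMeasurableEquiv μ hμ).symm
      (ContinuousMap.toLp 2 μ ℝ f) = ContinuousMap.toLp 2 μ ℝ (f.comp (shiftMap X (-1))) := by
    intro f
    rw [ContinuousLinearEquiv.symm_apply_eq, h1]
    congr 1
    ext x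
    simp [shiftMap_shiftMap]
  induction k using Int.induction_on generalizing f with
  | zero =>
    have : f.comp (shiftMap X 0) = f := by ext x; simp
    rw [this]
    rfl
  | succ n ih =>
    rw [zpow_add_one]
    change (koopman (sigma X).toMeasurableEquiv μ hμ ^ (n : ℤ))
      (koopman (sigma X).toMeasurableEquiv μ hμ _) = _
    rw [h1, ih]
    congr 1
    ext x
    simp [shiftMap_shiftMap]
  | pred n ih =>
    rw [zpow_sub_one]
    change (koopman (sigma X).toMeasurableEquiv μ hμ ^ (-n : ℤ))
      ((koopman (sigma X).toMeasurableEquiv μ hμ).symm _) = _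
    rw [h2, ih]
    congr 1
    ext x
    simp [shiftMap_shiftMap, sub_eq_add_neg]

theorem norm_koopman_zpow {α : Type*} [MeasurableSpace α] (T : α ≃ᵐ α) (μ : Measure α)
    (hT : MeasurePreserving T μ μ) (k : ℤ) (f : Lp ℝ 2 μ) :
    ‖(koopman T μ hT ^ k) f‖ = ‖f‖ := by
  have h1 : ∀ f, ‖koopman T μ hT f‖ = ‖f‖ := Lp.norm_compMeasurePreserving (hf := hT)
  have h2 : ∀ f, ‖(koopman T μ hT).symm f‖ = ‖f‖ := fun f => by
    rw [← h1, ContinuousLinearEquiv.apply_symm_apply]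
  induction k using Int.induction_on generalizing f with
  | zero => rfl
  | succ n ih =>
    rw [zpow_add_one]
    exact (ih _).trans (h1 f)
  | pred n ih =>
    rw [zpow_sub_one]
    exact (ih _).trans (h2 f)

theorem norm_toLp_le {X : Subshift A ℤ} (μ : Measure X.carrier) [IsProbabilityMeasure μ]
    (f : C(X.carrier, ℝ)) : ‖ContinuousMap.toLp 2 μ ℝ f‖ ≤ ‖f‖ := by
  have h := Lp.norm_le_of_ae_bound (f := ContinuousMap.toLp 2 μ ℝ f) (norm_nonneg f) (by
    filter_upwards [ContinuousMap.coeFn_toLp (p := 2) (𝕜 := ℝ) μ f] with x hx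
    rw [hx]
    exact f.norm_coe_le_norm x)
  simpa [measureUnivNNReal] using h

theorem integrable_continuousMap {X : Subshift A ℤ} (μ : Measure X.carrier) [IsFiniteMeasure μ]
    (f : C(X.carrier, ℝ)) : Integrable f μ :=
  f.continuous.integrable_of_hasCompactSupport (HasCompactSupport.of_compactSpace _)

theorem norm_toLp_sq {X : Subshift A ℤ} (μ : Measure X.carrier) [IsFiniteMeasure μ]
    (f : C(X.carrier, ℝ)) : ‖ContinuousMap.toLp 2 μ ℝ f‖ ^ 2 = ∫ x, f x ^ 2 ∂μ := by
  rw [← real_inner_self_eq_norm_sq, ContinuousMap.inner_toLp]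
  simp [sq]

/-- The indices of the towers whose measures do not vanish along `𝒰`. -/
def towerIndices {X : Subshift A ℤ} {ι : Type*} (μ : Measure X.carrier)
    (ψ : ℕ → ι → C(X.carrier, ℝ)) (h : ℕ → ι → ℕ) (𝒰 : Ultrafilter ℕ) : Set ι :=
  {i | ∃ c : ℝ, 0 < c ∧ ∀ᶠ l in (𝒰 : Filter ℕ), c ≤ h l i * ∫ x, ψ l i x ∂μ}

/-- A cylinder function approximating `f`, shifted to depend on nonnegative coordinates, is a
combination of level indicators, i.e. of translates of base indicators. Dropping the towers outside
`towerIndices` costs little, as their total mass is small. -/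
theorem approx_towers {X : Subshift A ℤ} {ι : Type*} [Fintype ι]
    {μ : Measure X.carrier} [IsProbabilityMeasure μ]
    (hμ : MeasurePreserving (sigma X).toMeasurableEquiv μ μ)
    {ψ : ℕ → ι → C(X.carrier, ℝ)} {h : ℕ → ι → ℕ}
    (hψ01 : ∀ l i x, ψ l i x = 0 ∨ ψ l i x = 1)
    (hsum : ∀ l x, ∑ i, ∑ j ∈ Finset.range (h l i), ψ l i (shiftMap X (-j : ℤ) x) = 1)
    (hψ : ∀ l i x y, ψ l i x = 1 → ψ l i y = 1 → ∀ m : ℕ, m < h l i + l → x.1 m = y.1 m)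
    {𝒰 : Ultrafilter ℕ} (h𝒰 : (𝒰 : Filter ℕ) ≤ atTop) (f : Lp ℝ 2 μ) (ε : ℝ) (hε : 0 < ε) :
    ∀ᶠ l in (𝒰 : Filter ℕ), ∃ y ∈ orbitSpan (koopman (sigma X).toMeasurableEquiv μ hμ)
      (Set.range fun i : towerIndices μ ψ h 𝒰 => ContinuousMap.toLp 2 μ ℝ (ψ l i)),
      ‖y - f‖ < ε := by
  classical
  set I := towerIndices μ ψ h 𝒰
  set U := koopman (sigma X).toMeasurableEquiv μ hμ
  obtain ⟨f₁, hf₁⟩ : ∃ f₁ : C(X.carrier, ℝ), ‖ContinuousMap.toLp 2 μ ℝ f₁ - f‖ < ε / 4 := by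
    obtain ⟨f₁, hf₁⟩ := (ContinuousMap.toLp_denseRange ℝ μ (p := 2) ℝ (by simp)).exists_dist_lt f
      (show 0 < ε / 4 by positivity)
    exact ⟨f₁, by rwa [dist_comm, dist_eq_norm] at hf₁⟩
  obtain ⟨g, q, hg, hgf⟩ := exists_cylinder_function f₁ (show 0 < ε / 4 by positivity)
  set G := g.comp (shiftMap X q)
  have hG := comp_shiftMap_congr hg
  have hGU : (U ^ (-q : ℤ)) (ContinuousMap.toLp 2 μ ℝ G) = ContinuousMap.toLp 2 μ ℝ g := by
    rw [koopman_zpow_toLp]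
    congr 1
    ext x
    simp [G, shiftMap_shiftMap]
  have hgf' : ‖ContinuousMap.toLp 2 μ ℝ g - f‖ < ε / 2 := by
    calc ‖ContinuousMap.toLp 2 μ ℝ g - f‖
        = ‖ContinuousMap.toLp 2 μ ℝ (g - f₁) + (ContinuousMap.toLp 2 μ ℝ f₁ - f)‖ := by
          rw [map_sub]; congr 1; abel
      _ ≤ ‖g - f₁‖ + ‖ContinuousMap.toLp 2 μ ℝ f₁ - f‖ :=
          (norm_add_le _ _).trans (by gcongr; exact norm_toLp_le μ _)
      _ < ε / 2 := by linarith
  set C := ‖G‖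
  obtain ⟨c, hc, hcε⟩ : ∃ c > 0, C ^ 2 * (Fintype.card ι * c) < (ε / 2) ^ 2 := by
    refine ⟨(ε / 2) ^ 2 / (1 + C ^ 2 * Fintype.card ι), by positivity, ?_⟩
    rw [← mul_assoc, mul_div_assoc', div_lt_iff₀ (by positivity)]
    have : 0 < (ε / 2) ^ 2 := by positivity
    nlinarith
  have hsmall : ∀ᶠ l in (𝒰 : Filter ℕ), ∀ i, i ∉ I → h l i * ∫ x, ψ l i x ∂μ < c := by
    refine eventually_all.2 fun i => ?_
    by_cases hi : i ∈ I
    · exact Eventually.of_forall fun l hl => absurd hi hl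
    · have : ¬ ∀ᶠ l in (𝒰 : Filter ℕ), c ≤ h l i * ∫ x, ψ l i x ∂μ := fun hcon => hi ⟨c, hc, hcon⟩
      -- The ultrafilter makes "not eventually at least `c`" into "eventually less than `c`".
      filter_upwards [Ultrafilter.eventually_not.2 this] with l hl _
      exact not_le.1 hl
  filter_upwards [hsmall, h𝒰 (eventually_ge_atTop (2 * q))] with l hl hql
  choose a ha using fun i => exists_level_const (hψ01 l i) (hψ l i) hG hql
  set y' : Lp ℝ 2 μ := ∑ i ∈ Finset.univ.filter (· ∈ I), ∑ j ∈ Finset.range (h l i),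
    a i j • ContinuousMap.toLp 2 μ ℝ ((ψ l i).comp (shiftMap X (-j : ℤ))) with hy'
  have hy'mem : y' ∈ orbitSpan U
      (Set.range fun i : I => ContinuousMap.toLp 2 μ ℝ (ψ l i)) := by
    refine Submodule.sum_mem _ fun i hi => Submodule.sum_mem _ fun j _ =>
      Submodule.smul_mem _ _ ?_
    rw [← koopman_zpow_toLp hμ]
    exact zpow_mem_orbitSpan U (Set.mem_range_self
      (f := fun i : I => ContinuousMap.toLp 2 μ ℝ (ψ l i)) ⟨i, (Finset.mem_filter.1 hi).2⟩) _
  -- Indicator of the union of the discarded towers.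
  set Ψ : C(X.carrier, ℝ) := ∑ i ∈ Finset.univ.filter (· ∉ I), ∑ j ∈ Finset.range (h l i),
    (ψ l i).comp (shiftMap X (-j : ℤ)) with hΨ
  have hψ0 : ∀ i x, 0 ≤ ψ l i x := fun i x => by
    rcases hψ01 l i x with h | h <;> rw [h]; norm_num
  have hΨx : ∀ x, Ψ x = ∑ i ∈ Finset.univ.filter (· ∉ I), ∑ j ∈ Finset.range (h l i),
      ψ l i (shiftMap X (-j : ℤ) x) := fun x => by simp [hΨ]
  have hΨ0 : ∀ x, 0 ≤ Ψ x := fun x => by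
    rw [hΨx]
    exact Finset.sum_nonneg fun i _ => Finset.sum_nonneg fun j _ => hψ0 _ _
  have hΨ1 : ∀ x, Ψ x ≤ 1 := fun x => by
    rw [hΨx, ← hsum l x]
    exact Finset.sum_le_sum_of_subset_of_nonneg (Finset.filter_subset _ _)
      fun i _ _ => Finset.sum_nonneg fun j _ => hψ0 _ _
  have hyG : y' - ContinuousMap.toLp 2 μ ℝ G = - ContinuousMap.toLp 2 μ ℝ (G * Ψ) := by
    simp only [hy', ← map_smul, ← map_sum, ← map_sub, ← map_neg]
    congr 1
    ext x
    have h1 := congrArg (G x * ·) (hsum l x)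
    simp only [mul_one] at h1
    rw [← Finset.sum_filter_add_sum_filter_not Finset.univ (· ∈ I), mul_add, ← hΨx x,
      Finset.mul_sum] at h1
    have h2 : ∀ i, G x * ∑ j ∈ Finset.range (h l i), ψ l i (shiftMap X (-j : ℤ) x) =
        ∑ j ∈ Finset.range (h l i), a i j * ψ l i (shiftMap X (-j : ℤ) x) := fun i => by
      rw [Finset.mul_sum]
      exact Finset.sum_congr rfl fun j hj => ha i j hj x
    simp only [h2] at h1
    simp only [ContinuousMap.sub_apply, ContinuousMap.coe_sum, Finset.sum_apply,
      ContinuousMap.smul_apply, ContinuousMap.comp_apply, smul_eq_mul, ContinuousMap.neg_apply,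
      ContinuousMap.mul_apply]
    linarith
  have hnorm : ‖y' - ContinuousMap.toLp 2 μ ℝ G‖ < ε / 2 := by
    rw [hyG, norm_neg]
    refine lt_of_pow_lt_pow_left₀ 2 (by positivity) (lt_of_le_of_lt ?_ hcε)
    rw [norm_toLp_sq]
    calc ∫ x, (G * Ψ) x ^ 2 ∂μ ≤ ∫ x, (C ^ 2 • Ψ) x ∂μ := by
          refine integral_mono (integrable_continuousMap μ ((G * Ψ) ^ 2))
            (integrable_continuousMap μ (C ^ 2 • Ψ)) fun x => ?_
          have h1 : G x ^ 2 ≤ C ^ 2 := by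
            have := G.norm_coe_le_norm x
            rw [Real.norm_eq_abs] at this
            exact sq_le_sq' (abs_le.1 this).1 (abs_le.1 this).2
          have h2 : Ψ x ^ 2 ≤ Ψ x := by nlinarith [hΨ0 x, hΨ1 x]
          simp only [ContinuousMap.mul_apply, ContinuousMap.smul_apply, smul_eq_mul, mul_pow]
          exact mul_le_mul h1 h2 (sq_nonneg _) (sq_nonneg _)
      _ = C ^ 2 * ∫ x, Ψ x ∂μ := by
          simp only [ContinuousMap.smul_apply, smul_eq_mul, integral_const_mul]
      _ ≤ C ^ 2 * (Fintype.card ι * c) := by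
          gcongr
          simp only [hΨx]
          have hint : ∀ i (j : ℕ), Integrable (fun x => ψ l i (shiftMap X (-j : ℤ) x)) μ :=
            fun i j => integrable_continuousMap μ ((ψ l i).comp (shiftMap X (-j : ℤ)))
          rw [integral_finsetSum _ fun i _ => integrable_finsetSum _ fun j _ => hint i j]
          have h3 : ∀ i ∈ Finset.univ.filter (· ∉ I), ∫ x, ∑ j ∈ Finset.range (h l i),
              ψ l i (shiftMap X (-j : ℤ) x) ∂μ ≤ c := by
            intro i hi
            rw [integral_finsetSum _ fun j _ => hint i j]
            simp only [integral_comp_shiftMap hμ _ _ (ψ l i).continuous, Finset.sum_const,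
              Finset.card_range, nsmul_eq_mul]
            exact (hl i (Finset.mem_filter.1 hi).2).le
          refine (Finset.sum_le_card_nsmul _ _ _ h3).trans ?_
          rw [nsmul_eq_mul]
          gcongr
          exact Finset.card_filter_le _ _
  refine ⟨(U ^ (-q : ℤ)) y', map_zpow_orbitSpan U _ hy'mem, ?_⟩
  calc ‖(U ^ (-q : ℤ)) y' - f‖ = ‖(U ^ (-q : ℤ)) (y' - ContinuousMap.toLp 2 μ ℝ G) +
        (ContinuousMap.toLp 2 μ ℝ g - f)‖ := by rw [map_sub, hGU]; congr 1; abel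
    _ ≤ ‖y' - ContinuousMap.toLp 2 μ ℝ G‖ + ‖ContinuousMap.toLp 2 μ ℝ g - f‖ :=
        (norm_add_le _ _).trans_eq (by rw [norm_koopman_zpow])
    _ < ε := by linarith

theorem ergodicMult_le {X : Subshift A ℤ} {ι : Type*} [Fintype ι]
    {μ : Measure X.carrier} [IsProbabilityMeasure μ]
    (hμ : Ergodic (sigma X).toMeasurableEquiv μ)
    {ψ : ℕ → ι → C(X.carrier, ℝ)} {h : ℕ → ι → ℕ}
    (hψ01 : ∀ l i x, ψ l i x = 0 ∨ ψ l i x = 1)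
    (hsum : ∀ l x, ∑ i, ∑ j ∈ Finset.range (h l i), ψ l i (shiftMap X (-j : ℤ) x) = 1)
    (hψ : ∀ l i x y, ψ l i x = 1 → ψ l i y = 1 → ∀ m : ℕ, m < h l i + l → x.1 m = y.1 m)
    {𝒰 : Ultrafilter ℕ} (h𝒰 : (𝒰 : Filter ℕ) ≤ atTop) :
    ergodicMult (sigma X).toMeasurableEquiv μ hμ ≤ (towerIndices μ ψ h 𝒰).encard := by
  classical
  have : TopologicalSpace.SeparableSpace (Lp ℝ 2 μ) :=
    (ContinuousMap.toLp_denseRange ℝ μ (p := 2) ℝ (by simp)).separableSpace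
      (ContinuousMap.toLp 2 μ ℝ).continuous
  have : SecondCountableTopology (Lp ℝ 2 μ) := UniformSpace.secondCountable_of_separable _
  have := Fintype.ofFinite (towerIndices μ ψ h 𝒰)
  refine (mult_koopman0_le _ μ hμ.toMeasurePreserving (l := (𝒰 : Filter ℕ)) _
    (approx_towers hμ.toMeasurePreserving hψ01 hsum hψ h𝒰)).trans_eq ?_
  rw [Set.encard_eq_coe_toFinset_card, Set.toFinset_card]

/-- Approximate in `L¹(μ + ν)` the indicator of a set of full `μ`-measure and zero `ν`-measure,
first by a continuous function, then uniformly by a cylinder function. -/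
theorem exists_separating_function {X : Subshift A ℤ} {μ ν : Measure X.carrier}
    [IsProbabilityMeasure μ] [IsProbabilityMeasure ν] (hμ : Ergodic (sigma X) μ)
    (hν : Ergodic (sigma X) ν) (hne : μ ≠ ν) {ε : ℝ} (hε : 0 < ε) :
    ∃ (G : C(X.carrier, ℝ)) (n : ℕ),
      (∀ x y : X.carrier, (∀ m : ℕ, m < n → x.1 m = y.1 m) → G x = G y) ∧
      ∫ x, |G x - 1| ∂μ < ε ∧ ∫ x, |G x| ∂ν < ε := by
  obtain ⟨s, hs, hνs, hμs⟩ := mutuallySingular_of_ergodic hμ hν hne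
  have hint : Integrable (s.indicator fun _ => (1 : ℝ)) (μ + ν) :=
    (integrable_const 1).indicator hs
  obtain ⟨f, hf, -⟩ := hint.exists_boundedContinuous_integral_sub_le
    (show 0 < ε / 4 by positivity)
  obtain ⟨g, q, hg, hgf⟩ := exists_cylinder_function f.toContinuousMap
    (show 0 < ε / 4 by positivity)
  have hle : ∀ (ρ : Measure X.carrier) [IsProbabilityMeasure ρ], ρ ≤ μ + ν →
      ∫ x, |g x - s.indicator (fun _ => (1 : ℝ)) x| ∂ρ < ε := by
    intro ρ _ hρ
    have h1 : Integrable (fun x => ‖s.indicator (fun _ => (1 : ℝ)) x - f x‖) (μ + ν) :=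
      (hint.sub (integrable_continuousMap _ f.toContinuousMap)).norm
    have h2 : ∫ x, ‖s.indicator (fun _ => (1 : ℝ)) x - f x‖ ∂ρ ≤ ε / 4 :=
      (integral_mono_measure hρ (Eventually.of_forall fun _ => norm_nonneg _) h1).trans hf
    calc ∫ x, |g x - s.indicator (fun _ => (1 : ℝ)) x| ∂ρ
        ≤ ∫ x, (‖s.indicator (fun _ => (1 : ℝ)) x - f x‖ + ε / 4) ∂ρ := by
          refine integral_mono ((integrable_continuousMap ρ g).sub (hint.mono_measure hρ)).abs
            ((h1.mono_measure hρ).add (integrable_const _)) fun x => ?_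
          have h3 : |g x - f x| ≤ ε / 4 :=
            ((g - f.toContinuousMap).norm_coe_le_norm x).trans hgf.le
          rw [Real.norm_eq_abs, abs_sub_comm]
          calc |s.indicator (fun _ => (1 : ℝ)) x - g x|
              ≤ |s.indicator (fun _ => (1 : ℝ)) x - f x| + |f x - g x| := abs_sub_le _ _ _
            _ ≤ _ := by rw [abs_sub_comm (f x)]; gcongr
      _ = ∫ x, ‖s.indicator (fun _ => (1 : ℝ)) x - f x‖ ∂ρ + ε / 4 := by
          rw [integral_add (h1.mono_measure hρ) (integrable_const _)]
          simp
      _ < ε := by linarith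
  refine ⟨g.comp (shiftMap X q), 2 * q, comp_shiftMap_congr hg, ?_, ?_⟩
  · have := integral_comp_shiftMap hμ.toMeasurePreserving q (fun x => |g x - 1|) (by fun_prop)
    simp only [ContinuousMap.comp_apply]
    rw [this]
    refine lt_of_eq_of_lt (integral_congr_ae ?_) (hle μ (Measure.le_add_right le_rfl))
    have : ∀ᵐ x ∂μ, x ∈ s := hμs
    filter_upwards [this] with x hx
    simp [hx]
  · have := integral_comp_shiftMap hν.toMeasurePreserving q (fun x => |g x|) (by fun_prop)
    simp only [ContinuousMap.comp_apply]
    rw [this]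
    refine lt_of_eq_of_lt (integral_congr_ae ?_) (hle ν (Measure.le_add_left le_rfl))
    have : ∀ᵐ x ∂ν, x ∉ s := measure_eq_zero_iff_ae_notMem.1 hνs
    filter_upwards [this] with x hx
    simp [hx]

/-- All levels of a tower have equal mass under an invariant measure, so the average of `G` over the
tower is the mean of the constants `a j` for `μ` and `ν` alike. If both give the tower mass at least
`c`, this mean is within `1/2` of both 1 and 0. -/
theorem disjoint_towerIndices {X : Subshift A ℤ} {ι : Type*} [Fintype ι]
    {μ ν : Measure X.carrier} [IsProbabilityMeasure μ] [IsProbabilityMeasure ν]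
    (hμ : Ergodic (sigma X) μ) (hν : Ergodic (sigma X) ν) (hne : μ ≠ ν)
    {ψ : ℕ → ι → C(X.carrier, ℝ)} {h : ℕ → ι → ℕ}
    (hψ01 : ∀ l i x, ψ l i x = 0 ∨ ψ l i x = 1)
    (hsum : ∀ l x, ∑ i, ∑ j ∈ Finset.range (h l i), ψ l i (shiftMap X (-j : ℤ) x) = 1)
    (hψ : ∀ l i x y, ψ l i x = 1 → ψ l i y = 1 → ∀ m : ℕ, m < h l i + l → x.1 m = y.1 m)
    {𝒰 : Ultrafilter ℕ} (h𝒰 : (𝒰 : Filter ℕ) ≤ atTop) :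
    Disjoint (towerIndices μ ψ h 𝒰) (towerIndices ν ψ h 𝒰) := by
  rw [Set.disjoint_left]
  rintro i ⟨c₁, hc₁, hi₁⟩ ⟨c₂, hc₂, hi₂⟩
  obtain ⟨c, hc, hcc₁, hcc₂⟩ : ∃ c > 0, c ≤ c₁ ∧ c ≤ c₂ :=
    ⟨min c₁ c₂, lt_min hc₁ hc₂, min_le_left _ _, min_le_right _ _⟩
  obtain ⟨G, n, hG, hGμ, hGν⟩ := exists_separating_function hμ hν hne (half_pos hc)
  obtain ⟨l, ⟨hl₁, hl₂⟩, hln⟩ := ((hi₁.and hi₂).and (h𝒰 (eventually_ge_atTop n))).exists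
  obtain ⟨a, ha⟩ := exists_level_const (hψ01 l i) (hψ l i) hG hln
  set H := h l i
  set Ψ : C(X.carrier, ℝ) := ∑ j ∈ Finset.range H, (ψ l i).comp (shiftMap X (-j : ℤ)) with hΨ
  have hΨx : ∀ x, Ψ x = ∑ j ∈ Finset.range H, ψ l i (shiftMap X (-j : ℤ) x) := fun x => by
    simp [hΨ]
  have hψ0 : ∀ i x, 0 ≤ ψ l i x := fun i x => by
    rcases hψ01 l i x with h | h <;> rw [h]; norm_num
  have hΨ0 : ∀ x, 0 ≤ Ψ x := fun x => by
    rw [hΨx]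
    exact Finset.sum_nonneg fun j _ => hψ0 _ _
  have hΨ1 : ∀ x, Ψ x ≤ 1 := fun x => by
    rw [hΨx, ← hsum l x]
    exact Finset.single_le_sum
      (f := fun i => ∑ j ∈ Finset.range (h l i), ψ l i (shiftMap X (-j : ℤ) x))
      (fun i _ => Finset.sum_nonneg fun j _ => hψ0 _ _) (Finset.mem_univ i)
  -- Integrate `G - t` over the tower: this gives `|∑ a j - t * H| * β < c / 2`, where `H * β ≥ c`.
  have hbound : ∀ (ρ : Measure X.carrier) [IsProbabilityMeasure ρ] (t : ℝ),
      MeasurePreserving (sigma X) ρ ρ → ∫ x, |G x - t| ∂ρ < c / 2 →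
      c ≤ H * ∫ x, ψ l i x ∂ρ → |∑ j ∈ Finset.range H, a j - t * H| * c < H * (c / 2) := by
    intro ρ _ t hρ ht hcρ
    set β := ∫ x, ψ l i x ∂ρ
    have hβ0 : 0 ≤ β := integral_nonneg (hψ0 i)
    have hH : (0 : ℝ) < H := by
      rcases Nat.eq_zero_or_pos H with h0 | h0
      · rw [h0, Nat.cast_zero, zero_mul] at hcρ
        linarith
      · exact_mod_cast h0
    have h1 : ∫ x, (G x - t) * Ψ x ∂ρ = (∑ j ∈ Finset.range H, a j - t * H) * β := by
      have h2 : ∀ x, (G x - t) * Ψ x =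
          ∑ j ∈ Finset.range H, (a j - t) * ψ l i (shiftMap X (-j : ℤ) x) := by
        intro x
        rw [hΨx, Finset.mul_sum]
        refine Finset.sum_congr rfl fun j hj => ?_
        rw [sub_mul, ha j hj, sub_mul]
      simp only [h2]
      have hint : ∀ j : ℕ, Integrable (fun x => ψ l i (shiftMap X (-j : ℤ) x)) ρ :=
        fun j => integrable_continuousMap ρ ((ψ l i).comp (shiftMap X (-j : ℤ)))
      rw [integral_finsetSum _ fun j _ => (hint j).const_mul _]
      simp only [integral_const_mul, integral_comp_shiftMap hρ _ _ (ψ l i).continuous]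
      rw [← Finset.sum_mul, Finset.sum_sub_distrib, Finset.sum_const, Finset.card_range,
        nsmul_eq_mul, mul_comm t]
    have h2 : |(∑ j ∈ Finset.range H, a j - t * H) * β| < c / 2 := by
      rw [← h1]
      refine (abs_integral_le_integral_abs).trans_lt (lt_of_le_of_lt ?_ ht)
      refine integral_mono (integrable_continuousMap ρ ((G - ContinuousMap.const _ t) * Ψ)).abs
        (integrable_continuousMap ρ (G - ContinuousMap.const _ t)).abs fun x => ?_
      change |(G x - t) * Ψ x| ≤ |G x - t|
      rw [abs_mul, abs_of_nonneg (hΨ0 x)]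
      exact mul_le_of_le_one_right (abs_nonneg _) (hΨ1 x)
    rw [abs_mul, abs_of_nonneg hβ0] at h2
    calc |∑ j ∈ Finset.range H, a j - t * H| * c
        ≤ |∑ j ∈ Finset.range H, a j - t * H| * (H * β) := by gcongr
      _ = H * (|∑ j ∈ Finset.range H, a j - t * H| * β) := by ring
      _ < H * (c / 2) := by gcongr
  have h1 := hbound μ 1 hμ.toMeasurePreserving hGμ (hcc₁.trans hl₁)
  have h0 := hbound ν 0 hν.toMeasurePreserving (by simpa using hGν) (hcc₂.trans hl₂)
  rw [one_mul] at h1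
  rw [zero_mul, sub_zero] at h0
  set t := ∑ j ∈ Finset.range H, a j
  have h2 : (H : ℝ) ≤ |t - H| + |t| := by
    have := abs_sub_le (H : ℝ) t 0
    rw [sub_zero, sub_zero, abs_of_nonneg (Nat.cast_nonneg H), abs_sub_comm] at this
    exact this
  nlinarith

end Measures
end SubshiftMult

/-! ### Summation over the ergodic measures -/

theorem mainTheorem2 {A : Type*} [Finite A] [TopologicalSpace A] [DiscreteTopology A]
    [MeasurableSpace A] [BorelSpace A]
    (X : SymbolicDynamics.FullShift.Subshift A ℤ) (hX : SubshiftMult.IsAperiodic X) (k : ℕ)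
    (hk : liminf (fun n : ℕ => (SubshiftMult.complexity X n : ℝ≥0∞) / (n : ℝ≥0∞)) atTop
      ≤ (k : ℝ≥0∞)) :
    ∑' μ : SubshiftMult.ErgodicMeasure X, ((μ.mult : ℕ∞) : ℝ≥0∞) ≤ 2 * (k : ℝ≥0∞) := by
  classical
  choose ψ h hψ01 hsum hψ using SubshiftMult.exists_towers hX hk
  set 𝒰 : Ultrafilter ℕ := Ultrafilter.of atTop
  have h𝒰 : (𝒰 : Filter ℕ) ≤ atTop := Ultrafilter.of_le atTop
  let I : SubshiftMult.ErgodicMeasure X → Finset (Fin (2 * k)) := fun μ =>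
    (SubshiftMult.towerIndices (μ.1 : Measure X.carrier) ψ h 𝒰).toFinset
  have hmult : ∀ μ : SubshiftMult.ErgodicMeasure X,
      ((μ.mult : ℕ∞) : ℝ≥0∞) ≤ ((I μ).card : ℝ≥0∞) := by
    intro μ
    have h1 : μ.mult ≤ (I μ).card := by
      rw [← Set.encard_eq_coe_toFinset_card]
      exact SubshiftMult.ergodicMult_le μ.2 hψ01 hsum hψ h𝒰
    exact_mod_cast ENat.toENNReal_mono h1
  -- Bounding finite partial sums suffices, so countability of the set of ergodic measures need not
  -- be known.
  rw [ENNReal.tsum_eq_iSup_sum]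
  refine iSup_le fun s => ?_
  have hdisj : (s : Set (SubshiftMult.ErgodicMeasure X)).PairwiseDisjoint I := by
    intro μ _ ν _ hne
    have hne' : (μ.1 : Measure X.carrier) ≠ ν.1 := fun heq =>
      hne (Subtype.ext (Subtype.ext heq))
    exact Set.disjoint_toFinset.2
      (SubshiftMult.disjoint_towerIndices μ.2 ν.2 hne' hψ01 hsum hψ h𝒰)
  calc ∑ μ ∈ s, ((μ.mult : ℕ∞) : ℝ≥0∞) ≤ ∑ μ ∈ s, ((I μ).card : ℝ≥0∞) :=
        Finset.sum_le_sum fun μ _ => hmult μ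
    _ = ((s.biUnion I).card : ℝ≥0∞) := by
        rw [Finset.card_biUnion fun μ hμ ν hν hne => hdisj hμ hν hne]
        push_cast
        rfl
    _ ≤ ((2 * k : ℕ) : ℝ≥0∞) := by
        have := (s.biUnion I).card_le_univ
        rw [Fintype.card_fin] at this
        exact_mod_cast this
    _ = 2 * (k : ℝ≥0∞) := by push_cast; rfl
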